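/- Let $n\ge 1$ and let $\{A(t)\}_{t=0}^\infty$, $A(t)=(a_{ij}(t))$, be a sequence of row-stochastic $n\times n$ real matrices (a stochastic chain). Assume that it is strongly aperiodic: there is $\gamma>0$ with $a_{ii}(t)\ge\gamma$ for all $i\in[n]$, $t\ge 0$; and approximately reciprocal: there are $p_0,\beta\in(0,\infty)$ such that for all $S\subset[n]$, with $\bar S=[n]\setminus S$, and all integers $0\le t_0<t_1$, $$p_0\sum_{t=t_0}^{t_1-1}\sum_{i\in S}\sum_{j\in\bar S}a_{ij}(t)\le\sum_{t=t_0}^{t_1-1}\sum_{i\in\bar S}\sum_{j\in S}a_{ij}(t)+\beta .$$ Definitions. The infinite flow graph $G^\infty$ is the undirected graph on $[n]$ in which $i\ne j$ are adjacent iff $\sum_{t\ge0}(a_{ij}(t)+a_{ji}(t))=\infty$. Write $A(t:t_0)=A(t-1)\cdots A(t_0)$ for $t\ge t_0$, with $A(t_0:t_0)=I$. A jet in $S\subset[n]$ is a sequence $J=\{J(t)\}_{t\ge0}$ of subsets of $S$; it is proper if $\emptyset\subsetneq J(t)\subsetneq S$ for all $t$; its limit, if it exists, is the set to which $J(t)$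 is equal for all large $t$. The chain has the infinite jet-flow property over $S$ if for every proper jet $J$ in $S$, with $\bar J(t)=[n]\setminus J(t)$, $$\sum_{t=0}^\infty\Big[\sum_{i\in J(t+1)}\sum_{j\in \bar J(t)}a_{ij}(t)+\sum_{i\in\bar J(t+1)}\sum_{j\in J(t)}a_{ij}(t)\Big]=\infty .$$ The chain is class-ergodic if $\lim_{t\to\infty}A(t:t_0)$ exists for every $t_0\ge 0$; its ergodic classes are the classes of the equivalence relation: $i\sim j$ iff $\lim_{t\to\infty}\big(A(t:t_0)_{ik}-A(t:t_0)_{jk}\big)=0$ for all $t_0\ge 0$ and $k\in[n]$. An absolute probability sequence is a sequence of stochastic vectors $\pi(t)$, $t\ge 0$, with $\pi(t+1)^TA(t)=\pi(t)^T$ for all $t$. A Sonin jet decomposition of the chain consists of an integer $c\ge1$ and jets $J^0,J^1,\dots,J^c$ in $[n]$ such that $J^0(t),\dots,J^c(t)$ are pairwise disjoint with union $[n]$ for every $t$, and: (a) for every absolute probability sequence $\pi$, $\lim_{t\to\infty}\sum_{i\in J^k(t)}\pi_i(t)$ exists for all $k$ and is $0$ for $k=0$; for each $k\ge1$ it is positive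 for some $\pi$; (b) for all $t_0\ge 0$, $x_0\in\mathbb R^n$ and $1\le k\le c$ there is $x^*\in\mathbb R$ such that the entries $(A(t:t_0)x_0)_i$, $i\in J^k(t)$, converge to $x^*$ as $t\to\infty$, uniformly over $i\in J^k(t)$; (c) for every absolute probability sequence $\pi$ and all $k\ne l$, $$\sum_{t=0}^\infty\Big[\sum_{i\in J^k(t+1)}\sum_{j\in J^l(t)}\pi_i(t+1)a_{ij}(t)+\sum_{i\in J^l(t+1)}\sum_{j\in J^k(t)}\pi_i(t+1)a_{ij}(t)\Big]<\infty .$$ Then: 1. The infinite jet-flow property holds over each connected component of $G^\infty$. 2. The chain is class-ergodic. 3. The ergodic classes of the chain are exactly the (vertex sets of the) connected components of $G^\infty$. Moreover, a Sonin jet decomposition of the chain exists, and in every Sonin jet decomposition $J^0,\dots,J^c$ each jet is constant after a finite time, the limit of $J^0$ is $\emptyset$, and $k\mapsto\lim_{t\to\infty}J^k(t)$ is a bijection from $\{1,\dots,c\}$ onto the set of connected components of $G^\infty$. -/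

import Mathlib

open Filter Topology
open scoped ENNReal

namespace StochasticChain

/-- A stochastic chain: a sequence `A(0), A(1), …` of row-stochastic `n × n` matrices. -/
def IsStochasticChain {n : ℕ} (A : ℕ → Matrix (Fin n) (Fin n) ℝ) : Prop :=
  ∀ t, A t ∈ Matrix.rowStochastic ℝ (Fin n)

/-- All diagonal entries are uniformly bounded away from zero. -/
def StronglyAperiodic {n : ℕ} (A : ℕ → Matrix (Fin n) (Fin n) ℝ) : Prop :=
  ∃ γ : ℝ, 0 < γ ∧ ∀ t i, γ ≤ A t i i

/-- For every cut `(S, Sᶜ)` and every time window `[t₀, t₁)`, the accumulated weights in the two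
directions are comparable, up to the factor `p₀` and the additive constant `β`. -/
def ApproximatelyReciprocal {n : ℕ} (A : ℕ → Matrix (Fin n) (Fin n) ℝ) : Prop :=
  ∃ p₀ β : ℝ, 0 < p₀ ∧ 0 < β ∧ ∀ (S : Finset (Fin n)) (t₀ t₁ : ℕ), t₀ < t₁ →
    p₀ * ∑ t ∈ Finset.Ico t₀ t₁, ∑ i ∈ S, ∑ j ∈ Sᶜ, A t i j ≤
      (∑ t ∈ Finset.Ico t₀ t₁, ∑ i ∈ Sᶜ, ∑ j ∈ S, A t i j) + β

/-- The product `A(t₁ + s - 1) ⋯ A(t₁)` of `s` consecutive matrices. -/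
def iterProd {n : ℕ} (A : ℕ → Matrix (Fin n) (Fin n) ℝ) (t₁ : ℕ) : ℕ → Matrix (Fin n) (Fin n) ℝ
  | 0 => 1
  | s + 1 => A (t₁ + s) * iterProd A t₁ s

/-- The backward product `A(t₂ : t₁) = A(t₂ - 1) ⋯ A(t₁)` for `t₁ ≤ t₂`, with `A(t : t) = I`
(only ever used for `t₁ ≤ t₂`, in limits `t₂ → ∞`). -/
def backProd {n : ℕ} (A : ℕ → Matrix (Fin n) (Fin n) ℝ) (t₂ t₁ : ℕ) : Matrix (Fin n) (Fin n) ℝ :=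
  iterProd A t₁ (t₂ - t₁)

/-- The infinite flow graph: `i ≠ j` are adjacent iff `∑ₜ (aᵢⱼ(t) + aⱼᵢ(t)) = ∞`. -/
def infiniteFlowGraph {n : ℕ} (A : ℕ → Matrix (Fin n) (Fin n) ℝ) : SimpleGraph (Fin n) where
  Adj i j := i ≠ j ∧ ∑' t, ENNReal.ofReal (A t i j + A t j i) = ∞
  symm := ⟨fun i j h => ⟨h.1.symm, by simpa only [add_comm] using h.2⟩⟩
  loopless := ⟨fun _ h => h.1 rfl⟩

/-- A jet: a sequence of sets of indices. -/
abbrev Jet (n : ℕ) : Type := ℕ → Finset (Fin n)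

/-- `J` is a proper jet in `S`: `∅ ⊊ J(t) ⊊ S` for all `t`. -/
def Jet.IsProperIn {n : ℕ} (J : Jet n) (S : Set (Fin n)) : Prop :=
  ∀ t, (J t).Nonempty ∧ (J t : Set (Fin n)) ⊂ S

/-- `L` is the limit of the jet `J`: the sequence `J(t)` equals `L` after a finite time. -/
def Jet.HasLimit {n : ℕ} (J : Jet n) (L : Set (Fin n)) : Prop :=
  ∃ T : ℕ, ∀ t, T ≤ t → (J t : Set (Fin n)) = L

/-- The total interaction `U_A(J, K)` of two jets over `[0, ∞)`. -/
noncomputable def totalInteraction {n : ℕ} (A : ℕ → Matrix (Fin n) (Fin n) ℝ) (J K : Jet n) :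
    ℝ≥0∞ :=
  ∑' t : ℕ, ENNReal.ofReal
    ((∑ i ∈ J (t + 1), ∑ j ∈ K t, A t i j) + ∑ i ∈ K (t + 1), ∑ j ∈ J t, A t i j)

/-- The infinite jet-flow property over `S`: every proper jet in `S` has infinite total
interaction with its complement. -/
def InfiniteJetFlow {n : ℕ} (A : ℕ → Matrix (Fin n) (Fin n) ℝ) (S : Set (Fin n)) : Prop :=
  ∀ J : Jet n, J.IsProperIn S → totalInteraction A J (fun t => (J t)ᶜ) = ∞

/-- The limit of `A(t : t₀)` as `t → ∞` exists for every `t₀`. -/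
def ClassErgodic {n : ℕ} (A : ℕ → Matrix (Fin n) (Fin n) ℝ) : Prop :=
  ∀ t₀ : ℕ, ∃ L : Matrix (Fin n) (Fin n) ℝ, Tendsto (fun t => backProd A t t₀) atTop (𝓝 L)

/-- `i` and `j` are equivalent iff `A(t : t₀)ᵢₖ - A(t : t₀)ⱼₖ → 0` as `t → ∞`, for all `t₀`
and `k`. -/
def ergodicSetoid {n : ℕ} (A : ℕ → Matrix (Fin n) (Fin n) ℝ) : Setoid (Fin n) where
  r i j := ∀ (t₀ : ℕ) (k : Fin n),
    Tendsto (fun t => backProd A t t₀ i k - backProd A t t₀ j k) atTop (𝓝 0)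
  iseqv :=
    { refl := fun i t₀ k => by simp
      symm := fun h t₀ k => by simpa using (h t₀ k).neg
      trans := fun h h' t₀ k => by simpa using (h t₀ k).add (h' t₀ k) }

/-- The ergodic classes of the chain, as a collection of subsets of the index set. -/
def ergodicClasses {n : ℕ} (A : ℕ → Matrix (Fin n) (Fin n) ℝ) : Set (Set (Fin n)) :=
  (ergodicSetoid A).classes

/-- `π` is an absolute probability sequence: stochastic vectors with `π(t+1)ᵀ A(t) = π(t)ᵀ`. -/
def IsAbsProbSeq {n : ℕ} (A : ℕ → Matrix (Fin n) (Fin n) ℝ) (π : ℕ → Fin n → ℝ) : Prop :=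
  ∀ t, π t ∈ stdSimplex ℝ (Fin n) ∧ Matrix.vecMul (π (t + 1)) (A t) = π t

/-- The total flow between two jets, where the volume carried from `j` at time `t` to `i` at time
`t + 1` is `πᵢ(t+1) aᵢⱼ(t)`. -/
noncomputable def totalFlow {n : ℕ} (A : ℕ → Matrix (Fin n) (Fin n) ℝ) (π : ℕ → Fin n → ℝ)
    (J K : Jet n) : ℝ≥0∞ :=
  ∑' t : ℕ, ENNReal.ofReal
    ((∑ i ∈ J (t + 1), ∑ j ∈ K t, π (t + 1) i * A t i j) +
      ∑ i ∈ K (t + 1), ∑ j ∈ J t, π (t + 1) i * A t i j)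

/-- Sonin's decomposition into jets, for the averaging dynamics `x(t+1) = A(t) x(t)`.
An absolute probability sequence `π` plays the role of the volumes (the volume `πⱼ(t)` in cup `j`
at time `t` is split as `πⱼ(t) = ∑ᵢ πᵢ(t+1) aᵢⱼ(t)`), and `x` the role of the concentrations,
which are then updated by `x(t+1) = A(t) x(t)`. The jets `J 0, J 1, …, J c` partition the index
set at each time; `J 0` is the negligible jet. The requirements hold irrespective of the volumes
`π` and of the time and the values at which `x` is started. -/
structure IsSoninDecomposition {n : ℕ} (A : ℕ → Matrix (Fin n) (Fin n) ℝ) (c : ℕ)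
    (J : Fin (c + 1) → Jet n) : Prop where
  one_le : 1 ≤ c
  /-- At each time, every index belongs to exactly one of the jets. -/
  partition : ∀ (t : ℕ) (i : Fin n), ∃! k, i ∈ J k t
  /-- The volume of each jet converges. -/
  volume : ∀ π, IsAbsProbSeq A π → ∀ k, ∃ m : ℝ, Tendsto (fun t => ∑ i ∈ J k t, π t i) atTop (𝓝 m)
  /-- The volume of the jet `J 0` vanishes in the limit. -/
  volume_zero : ∀ π, IsAbsProbSeq A π → Tendsto (fun t => ∑ i ∈ J 0 t, π t i) atTop (𝓝 0)
  /-- None of the jets `J 1, …, J c` is negligible. -/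
  volume_pos : ∀ k : Fin c, ∃ π, IsAbsProbSeq A π ∧
    ∃ m : ℝ, 0 < m ∧ Tendsto (fun t => ∑ i ∈ J k.succ t, π t i) atTop (𝓝 m)
  /-- In each of the jets `J 1, …, J c`, the concentrations converge to a common limit. -/
  concentration : ∀ (t₀ : ℕ) (x₀ : Fin n → ℝ) (k : Fin c), ∃ xLim : ℝ, ∀ ε : ℝ, 0 < ε →
    ∃ T : ℕ, ∀ t, t₀ ≤ t → T ≤ t → ∀ i ∈ J k.succ t,
      |(backProd A t t₀).mulVec x₀ i - xLim| < ε
  /-- The total flow between any two distinct jets is finite. -/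
  flow : ∀ π, IsAbsProbSeq A π → ∀ k l, k ≠ l → totalFlow A π (J k) (J l) < ∞

end StochasticChain

namespace StochasticChain

variable {n : ℕ} {A : ℕ → Matrix (Fin n) (Fin n) ℝ}

/-! ### Row-stochastic chains and their products -/

/-! Everything rests on a uniform positive lower bound `δ` for the column sums of all products `A(b
: s)` (`exists_le_colSum`): no index ever loses its influence.

To prove it, start with value `1` at one index and let `J` be a set on which values are still
comparable to `1`. If the rows outside `J` take little total weight from `J`, reciprocity bounds the
weight that `J` takes from outside, and aperiodicity makes `J` keep a fixed fraction of its values.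
Otherwise, stop when about one unit has been taken. The value passed to `Jᶜ` then evolves
essentially by the chain with `J` frozen (`decouple`), which is still reciprocal and has fewer
active indices, so by induction a fixed fraction of it survives and some index can be added to `J`.
After at most `n` enlargements `J` is everything.

With column sums as weights, the quadratic energy of an orbit drops at each step by at least `δγ`
times the dispersion, so the dispersion is summable (`IsOrbit.summable_dispersion`). A component of
the infinite flow graph exchanges only finite weight with its complement, while every cut inside it
carries infinite weight. A persistent spread of values inside it would leave a gap across some cut
and dissipate too much energy; hence consensus on each component (`IsOrbit.exists_tendsto`). This
gives class-ergodicity. Distinct components are not equivalent, since late products leave nearly all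
the weight of a component inside it.

The components, with an empty `J 0`, form a Sonin decomposition. Conversely, the column-sum bound
yields an absolute probability sequence bounded below, so finite flow between jets means finite
weight between them. An index changing jets carries its own diagonal weight, so this happens
finitely often; the final jets are unions of components, and common concentrations make each a
single one. -/

lemma IsStochasticChain.nonneg (hA : IsStochasticChain A) (t : ℕ) (i j : Fin n) : 0 ≤ A t i j :=
  (hA t).1 i j

lemma IsStochasticChain.sum_row (hA : IsStochasticChain A) (t : ℕ) (i : Fin n) :
    ∑ j, A t i j = 1 := by
  have := congrFun (hA t).2 i
  simpa [Matrix.mulVec, dotProduct] using this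

lemma IsStochasticChain.le_one (hA : IsStochasticChain A) (t : ℕ) (i j : Fin n) : A t i j ≤ 1 :=
  hA.sum_row t i ▸ Finset.single_le_sum (fun j _ => hA.nonneg t i j) (Finset.mem_univ j)

@[simp] lemma backProd_self (A : ℕ → Matrix (Fin n) (Fin n) ℝ) (s : ℕ) : backProd A s s = 1 := by
  simp [backProd, iterProd]

lemma backProd_succ (A : ℕ → Matrix (Fin n) (Fin n) ℝ) {s t : ℕ} (h : s ≤ t) :
    backProd A (t + 1) s = A t * backProd A t s := by
  have h1 : t + 1 - s = (t - s) + 1 := by omega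
  have h2 : s + (t - s) = t := by omega
  rw [backProd, h1, iterProd, h2, backProd]

lemma backProd_mul (A : ℕ → Matrix (Fin n) (Fin n) ℝ) {s r t : ℕ} (hsr : s ≤ r) (hrt : r ≤ t) :
    backProd A t s = backProd A t r * backProd A r s := by
  induction t, hrt using Nat.le_induction with
  | base => simp
  | succ t hrt ih =>
    rw [backProd_succ A (hsr.trans hrt), backProd_succ A hrt, ih, mul_assoc]

lemma backProd_eq_mul (A : ℕ → Matrix (Fin n) (Fin n) ℝ) {s t : ℕ} (h : s < t) :
    backProd A t s = backProd A t (s + 1) * A s := by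
  rw [backProd_mul A (Nat.le_succ s) h, backProd_succ A le_rfl, backProd_self, mul_one]

lemma IsStochasticChain.backProd_mem (hA : IsStochasticChain A) {s t : ℕ} (h : s ≤ t) :
    backProd A t s ∈ Matrix.rowStochastic ℝ (Fin n) := by
  induction t, h using Nat.le_induction with
  | base => rw [backProd_self]; exact one_mem _
  | succ t h ih => rw [backProd_succ A h]; exact mul_mem (hA t) ih

lemma IsStochasticChain.backProd_nonneg (hA : IsStochasticChain A) {s t : ℕ} (h : s ≤ t)
    (i j : Fin n) : 0 ≤ backProd A t s i j :=
  (hA.backProd_mem h).1 i j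

lemma IsStochasticChain.backProd_sum_row (hA : IsStochasticChain A) {s t : ℕ} (h : s ≤ t)
    (i : Fin n) : ∑ j, backProd A t s i j = 1 := by
  have := congrFun (hA.backProd_mem h).2 i
  simpa [Matrix.mulVec, dotProduct] using this

/-! ### Orbits -/

/-- `x` follows the dynamics `x(t+1) = A(t) x(t)` from time `s` on. -/
def IsOrbit (A : ℕ → Matrix (Fin n) (Fin n) ℝ) (s : ℕ) (x : ℕ → Fin n → ℝ) : Prop :=
  ∀ t, s ≤ t → ∀ i, x (t + 1) i = ∑ j, A t i j * x t j

lemma IsOrbit.mono {s s' : ℕ} {x : ℕ → Fin n → ℝ} (hx : IsOrbit A s x) (h : s ≤ s') :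
    IsOrbit A s' x := fun t ht => hx t (h.trans ht)

lemma isOrbit_backProd (A : ℕ → Matrix (Fin n) (Fin n) ℝ) (s : ℕ) (x₀ : Fin n → ℝ) :
    IsOrbit A s (fun t => (backProd A t s).mulVec x₀) := by
  intro t ht i
  simp only [backProd_succ A ht, ← Matrix.mulVec_mulVec]
  rfl

lemma isOrbit_backProd_col (A : ℕ → Matrix (Fin n) (Fin n) ℝ) (s : ℕ) (k : Fin n) :
    IsOrbit A s (fun t i => backProd A t s i k) := by
  intro t ht i
  simp only [backProd_succ A ht, Matrix.mul_apply]

lemma IsOrbit.le_of_le (hA : IsStochasticChain A) {s : ℕ} {x : ℕ → Fin n → ℝ}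
    (hx : IsOrbit A s x) {m : ℝ} (h : ∀ i, m ≤ x s i) {t : ℕ} (ht : s ≤ t) (i : Fin n) :
    m ≤ x t i := by
  induction t, ht using Nat.le_induction generalizing i with
  | base => exact h i
  | succ t ht ih =>
    rw [hx t ht, ← one_mul m, ← hA.sum_row t i, Finset.sum_mul]
    exact Finset.sum_le_sum fun j _ => mul_le_mul_of_nonneg_left (ih j) (hA.nonneg t i j)

lemma IsOrbit.neg {s : ℕ} {x : ℕ → Fin n → ℝ} (hx : IsOrbit A s x) :
    IsOrbit A s (fun t i => - x t i) := by
  intro t ht i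
  simp [hx t ht]

lemma IsOrbit.abs_apply_le (hA : IsStochasticChain A) {s : ℕ} {x : ℕ → Fin n → ℝ}
    (hx : IsOrbit A s x) {m : ℝ} (h : ∀ i, |x s i| ≤ m) {t : ℕ} (ht : s ≤ t) (i : Fin n) :
    |x t i| ≤ m := by
  have h1 := hx.le_of_le hA (m := -m) (fun i => (abs_le.1 (h i)).1) ht i
  have h2 := hx.neg.le_of_le hA (m := -m) (fun i => neg_le_neg (abs_le.1 (h i)).2) ht i
  exact abs_le.2 ⟨h1, neg_le_neg_iff.1 h2⟩

/-! ### Cuts -/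

/-- The total weight of the entries with row in `S` and column in `T`. -/
def cut (M : Matrix (Fin n) (Fin n) ℝ) (S T : Finset (Fin n)) : ℝ := ∑ i ∈ S, ∑ j ∈ T, M i j

lemma cut_eq_sum_ite (M : Matrix (Fin n) (Fin n) ℝ) (S T : Finset (Fin n)) :
    cut M S T = ∑ i, ∑ j, if i ∈ S ∧ j ∈ T then M i j else 0 := by
  simp only [cut, ite_and]
  rw [← Finset.sum_subset (Finset.subset_univ S)]
  · exact Finset.sum_congr rfl fun i hi => by simp [hi]
  · intro i _ hi
    simp [hi]

lemma cut_nonneg (hA : IsStochasticChain A) (t : ℕ) (S T : Finset (Fin n)) : 0 ≤ cut (A t) S T :=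
  Finset.sum_nonneg fun _ _ => Finset.sum_nonneg fun _ _ => hA.nonneg _ _ _

lemma sum_le_cut (hA : IsStochasticChain A) (t : ℕ) {S T : Finset (Fin n)} {i : Fin n}
    (hi : i ∈ S) : ∑ j ∈ T, A t i j ≤ cut (A t) S T :=
  Finset.single_le_sum (f := fun i => ∑ j ∈ T, A t i j)
    (fun _ _ => Finset.sum_nonneg fun _ _ => hA.nonneg _ _ _) hi

lemma le_cut (hA : IsStochasticChain A) (t : ℕ) {S T : Finset (Fin n)} {i j : Fin n}
    (hi : i ∈ S) (hj : j ∈ T) : A t i j ≤ cut (A t) S T :=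
  (Finset.single_le_sum (fun j _ => hA.nonneg t i j) hj).trans (sum_le_cut hA t hi)

lemma cut_le (hA : IsStochasticChain A) (t : ℕ) (S T : Finset (Fin n)) : cut (A t) S T ≤ n := by
  calc cut (A t) S T ≤ ∑ i : Fin n, ∑ j : Fin n, A t i j := by
        refine (Finset.sum_le_sum fun i _ => Finset.sum_le_univ_sum_of_nonneg
          fun j => hA.nonneg t i j).trans ?_
        exact Finset.sum_le_univ_sum_of_nonneg fun i => Finset.sum_nonneg fun j _ => hA.nonneg t i j
    _ = n := by simp [hA.sum_row t]

/-! ### Lower bounds on the influence of every index -/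

/-- Since `a ≥ γ`, `a + u ≤ a (1 + u/γ) ≤ a exp(u/γ)`. The exponential form lets one-step losses
multiply into a bound depending only on the accumulated weight, with no smallness condition on `u`.
-/
lemma exp_neg_mul_add_le {γ a u : ℝ} (hγ : 0 < γ) (ha : γ ≤ a) (hu : 0 ≤ u) :
    Real.exp (-(u / γ)) * (a + u) ≤ a := by
  have h1 : u / γ + 1 ≤ Real.exp (u / γ) := Real.add_one_le_exp _
  have h2 : a + u ≤ a * Real.exp (u / γ) := by
    have : u ≤ a * (u / γ) := by
      rw [mul_div_assoc', le_div_iff₀ hγ, mul_comm]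
      exact mul_le_mul_of_nonneg_right ha hu
    nlinarith [hγ.trans_le ha]
  rw [Real.exp_neg, inv_mul_le_iff₀ (Real.exp_pos _), mul_comm]
  exact h2

/-- The values on a set decay at most exponentially in the weight leaving it. -/
lemma IsOrbit.le_on_set (hA : IsStochasticChain A) {γ : ℝ} (hγ : 0 < γ)
    (hdiag : ∀ t i, γ ≤ A t i i) {s : ℕ} {x : ℕ → Fin n → ℝ} (hx : IsOrbit A s x)
    (hx0 : ∀ i, 0 ≤ x s i) {J : Finset (Fin n)} {v : ℝ} (hv : 0 ≤ v) (hJ : ∀ i ∈ J, v ≤ x s i)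
    {t : ℕ} (ht : s ≤ t) {i : Fin n} (hi : i ∈ J) :
    v * Real.exp (-((∑ τ ∈ Finset.Ico s t, cut (A τ) J Jᶜ) / γ)) ≤ x t i := by
  induction t, ht using Nat.le_induction generalizing i with
  | base => simpa using hJ i hi
  | succ t ht ih =>
    set w := v * Real.exp (-((∑ τ ∈ Finset.Ico s t, cut (A τ) J Jᶜ) / γ)) with hw
    have hw0 : 0 ≤ w := by positivity
    have hsplit : ∑ j ∈ J, A t i j + ∑ j ∈ Jᶜ, A t i j = 1 := by
      rw [Finset.sum_add_sum_compl, hA.sum_row]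
    have hin : γ ≤ ∑ j ∈ J, A t i j :=
      (hdiag t i).trans (Finset.single_le_sum (fun j _ => hA.nonneg t i j) hi)
    have hout : 0 ≤ ∑ j ∈ Jᶜ, A t i j := Finset.sum_nonneg fun j _ => hA.nonneg t i j
    -- Row `i` splits into weight `a ≥ γ` on `J` and `u` outside, with `a + u = 1`; hence `a ≥
    -- exp(-u/γ)`.
    have h1 := exp_neg_mul_add_le hγ hin hout
    rw [hsplit, mul_one] at h1
    have h2 : Real.exp (-(cut (A t) J Jᶜ / γ)) ≤ ∑ j ∈ J, A t i j := by
      refine le_trans (Real.exp_le_exp.2 (neg_le_neg ?_)) h1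
      gcongr
      exact sum_le_cut hA t hi
    rw [Finset.sum_Ico_succ_top ht, add_div, neg_add, Real.exp_add, ← mul_assoc, ← hw, hx t ht]
    calc w * Real.exp (-(cut (A t) J Jᶜ / γ)) ≤ w * ∑ j ∈ J, A t i j := by gcongr
      _ = ∑ j ∈ J, A t i j * w := by rw [Finset.mul_sum]; simp only [mul_comm]
      _ ≤ ∑ j ∈ J, A t i j * x t j :=
        Finset.sum_le_sum fun j hj => mul_le_mul_of_nonneg_left (ih hj) (hA.nonneg t i j)
      _ ≤ ∑ j, A t i j * x t j := Finset.sum_le_univ_sum_of_nonneg fun j =>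
        mul_nonneg (hA.nonneg t i j) (hx.le_of_le hA hx0 ht j)

/-- The chain in which the indices in `J` are frozen, and the remaining ones put the weight they
gave to `J` on themselves. -/
def decouple (A : ℕ → Matrix (Fin n) (Fin n) ℝ) (J : Finset (Fin n)) :
    ℕ → Matrix (Fin n) (Fin n) ℝ := fun t => Matrix.of fun i j =>
  if i ∈ J then (if i = j then 1 else 0) else
    if j ∈ J then 0 else A t i j + if i = j then ∑ l ∈ J, A t i l else 0

lemma IsStochasticChain.decouple (hA : IsStochasticChain A) (J : Finset (Fin n)) :
    IsStochasticChain (decouple A J) := by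
  intro t
  refine ⟨fun i j => ?_, ?_⟩
  · have h1 := hA.nonneg t i j
    have h2 : 0 ≤ ∑ l ∈ J, A t i l := Finset.sum_nonneg fun l _ => hA.nonneg t i l
    simp only [StochasticChain.decouple, Matrix.of_apply]
    split_ifs <;> linarith
  · ext i
    simp only [Matrix.mulVec, dotProduct, StochasticChain.decouple, Matrix.of_apply, mul_one,
      Pi.one_apply]
    by_cases hi : i ∈ J
    · simp [hi]
    · have h1 : ∀ j, (if j ∈ J then 0 else A t i j + if i = j then ∑ l ∈ J, A t i l else 0) =
          (if j ∈ J then 0 else A t i j) + if i = j then ∑ l ∈ J, A t i l else 0 := by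
        intro j
        by_cases hj : j ∈ J
        · have : i ≠ j := fun h => hi (h ▸ hj)
          simp [hj, this]
        · simp [hj]
      have h2 : ∑ j, (if j ∈ J then 0 else A t i j) = ∑ j ∈ Jᶜ, A t i j := by
        rw [Finset.sum_ite]
        simp only [Finset.sum_const_zero, zero_add]
        refine Finset.sum_congr ?_ fun _ _ => rfl
        ext; simp
      simp only [hi, if_false, h1, Finset.sum_add_distrib, h2, Finset.sum_ite_eq, Finset.mem_univ,
        if_true]
      rw [Finset.sum_compl_add_sum, hA.sum_row]

lemma le_decouple_diag (hA : IsStochasticChain A) {γ : ℝ} (hγ : γ ≤ 1)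
    (hdiag : ∀ t i, γ ≤ A t i i) (J : Finset (Fin n)) (t : ℕ) (i : Fin n) :
    γ ≤ decouple A J t i i := by
  have h1 := hdiag t i
  have h2 : 0 ≤ ∑ l ∈ J, A t i l := Finset.sum_nonneg fun l _ => hA.nonneg t i l
  simp only [decouple, Matrix.of_apply, if_true]
  split_ifs <;> linarith

lemma decouple_eq_zero {J : Finset (Fin n)} {i j : Fin n} (hi : i ∈ J) (hj : j ∉ J) (t : ℕ) :
    decouple A J t i j = 0 := by
  have : i ≠ j := fun h => hj (h ▸ hi)
  simp [decouple, hi, this]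

/-- Outside `J`, decoupling changes only the diagonal, which was already at least `γ`; the added
weight therefore costs at most an exponential factor. So the true chain dominates the discounted
decoupled one. -/
lemma exp_mul_decouple_le (hA : IsStochasticChain A) {γ : ℝ} (hγ : 0 < γ)
    (hdiag : ∀ t i, γ ≤ A t i i) {J : Finset (Fin n)} (t : ℕ) {i j : Fin n} (hi : i ∉ J)
    (hj : j ∉ J) : Real.exp (-(cut (A t) Jᶜ J / γ)) * decouple A J t i j ≤ A t i j := by
  have hu : 0 ≤ ∑ l ∈ J, A t i l := Finset.sum_nonneg fun l _ => hA.nonneg t i l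
  have hle : ∑ l ∈ J, A t i l ≤ cut (A t) Jᶜ J := sum_le_cut hA t (Finset.mem_compl.2 hi)
  simp only [decouple, Matrix.of_apply, hi, hj, if_false]
  by_cases h : i = j
  · subst h
    simp only [if_true]
    refine le_trans (mul_le_mul_of_nonneg_right (Real.exp_le_exp.2 (neg_le_neg ?_)) ?_)
      (exp_neg_mul_add_le hγ (hdiag t i) hu)
    · gcongr
    · linarith [hA.nonneg t i i]
  · simp only [h, if_false, add_zero]
    refine mul_le_of_le_one_left (hA.nonneg t i j) (Real.exp_le_one_iff.2 ?_)
    have := cut_nonneg hA t Jᶜ J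
    rw [neg_nonpos]
    positivity

/-- Approximate reciprocity in the time windows contained in `[s, b)`. -/
def ReciprocalOn (A : ℕ → Matrix (Fin n) (Fin n) ℝ) (p β : ℝ) (s b : ℕ) : Prop :=
  ∀ (S : Finset (Fin n)) (t₀ t₁ : ℕ), s ≤ t₀ → t₀ ≤ t₁ → t₁ ≤ b →
    p * ∑ t ∈ Finset.Ico t₀ t₁, cut (A t) S Sᶜ ≤ (∑ t ∈ Finset.Ico t₀ t₁, cut (A t) Sᶜ S) + β

lemma ReciprocalOn.mono {p β : ℝ} {s b s' b' : ℕ} (h : ReciprocalOn A p β s b) (hs : s ≤ s')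
    (hb : b' ≤ b) : ReciprocalOn A p β s' b' :=
  fun S t₀ t₁ h₀ h₁ h₂ => h S t₀ t₁ (hs.trans h₀) h₁ (h₂.trans hb)

lemma cut_decouple_le (hA : IsStochasticChain A) (J S : Finset (Fin n)) (t : ℕ) :
    cut (decouple A J t) S Sᶜ ≤ cut (A t) (S \ J) (S \ J)ᶜ := by
  simp only [cut_eq_sum_ite]
  refine Finset.sum_le_sum fun i _ => Finset.sum_le_sum fun j _ => ?_
  have := hA.nonneg t i j
  by_cases hij : i = j
  · subst hij
    simp only [Finset.mem_compl, Finset.mem_sdiff]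
    split_ifs <;> first | linarith | (exfalso; tauto)
  · simp only [decouple, Matrix.of_apply, hij, if_false, Finset.mem_compl, Finset.mem_sdiff]
    split_ifs <;> first | linarith | (exfalso; tauto)

lemma cut_le_cut_decouple (hA : IsStochasticChain A) (J S : Finset (Fin n)) (t : ℕ) :
    cut (A t) (S \ J)ᶜ (S \ J) ≤ cut (decouple A J t) Sᶜ S + cut (A t) J Jᶜ := by
  simp only [cut_eq_sum_ite, ← Finset.sum_add_distrib]
  refine Finset.sum_le_sum fun i _ => Finset.sum_le_sum fun j _ => ?_
  have := hA.nonneg t i j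
  by_cases hij : i = j
  · subst hij
    simp only [Finset.mem_compl, Finset.mem_sdiff]
    split_ifs <;> first | linarith | (exfalso; tauto)
  · simp only [decouple, Matrix.of_apply, hij, if_false, Finset.mem_compl, Finset.mem_sdiff]
    split_ifs <;> first | linarith | (exfalso; tauto)

/-- A cut `S` of the decoupled chain is compared with the cut `S \ J` of the original. Of the
reverse weight, decoupling loses only entries with row in `J` and column outside it, whose total is
at most `C`. -/
lemma ReciprocalOn.decouple (hA : IsStochasticChain A) {p β C : ℝ} (hp : 0 ≤ p) {s b : ℕ}
    (h : ReciprocalOn A p β s b) {J : Finset (Fin n)}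
    (hC : ∑ t ∈ Finset.Ico s b, cut (A t) J Jᶜ ≤ C) :
    ReciprocalOn (decouple A J) p (β + C) s b := by
  intro S t₀ t₁ h₀ h₁ h₂
  have h3 : ∑ t ∈ Finset.Ico t₀ t₁, cut (A t) J Jᶜ ≤ ∑ t ∈ Finset.Ico s b, cut (A t) J Jᶜ :=
    Finset.sum_le_sum_of_subset_of_nonneg (Finset.Ico_subset_Ico h₀ h₂)
      fun t _ _ => cut_nonneg hA t _ _
  have h4 := h (S \ J) t₀ t₁ h₀ h₁ h₂
  have h5 : ∑ t ∈ Finset.Ico t₀ t₁, cut (StochasticChain.decouple A J t) S Sᶜ ≤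
      ∑ t ∈ Finset.Ico t₀ t₁, cut (A t) (S \ J) (S \ J)ᶜ :=
    Finset.sum_le_sum fun t _ => cut_decouple_le hA J S t
  have h6 : ∑ t ∈ Finset.Ico t₀ t₁, cut (A t) (S \ J)ᶜ (S \ J) ≤
      ∑ t ∈ Finset.Ico t₀ t₁, cut (StochasticChain.decouple A J t) Sᶜ S +
        ∑ t ∈ Finset.Ico t₀ t₁, cut (A t) J Jᶜ := by
    rw [← Finset.sum_add_distrib]
    exact Finset.sum_le_sum fun t _ => cut_le_cut_decouple hA J S t
  have := mul_le_mul_of_nonneg_left h5 hp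
  linarith

/-- The `j`-th column sum of `A(b : t)`. -/
def colSum (A : ℕ → Matrix (Fin n) (Fin n) ℝ) (b t : ℕ) (j : Fin n) : ℝ :=
  ∑ i, backProd A b t i j

lemma colSum_eq (A : ℕ → Matrix (Fin n) (Fin n) ℝ) {t b : ℕ} (h : t < b) (j : Fin n) :
    colSum A b t j = ∑ i, colSum A b (t + 1) i * A t i j := by
  simp only [colSum, backProd_eq_mul A h, Matrix.mul_apply, Finset.sum_mul]
  exact Finset.sum_comm

/-- If a set `J` keeps values at least `w`, then the mass entering its complement is, up to a factor
depending on the influences in the decoupled chain, still there at the end. -/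
lemma IsOrbit.le_sum_compl (hA : IsStochasticChain A) {γ : ℝ} (hγ : 0 < γ)
    (hdiag : ∀ t i, γ ≤ A t i i) {s b : ℕ} {x : ℕ → Fin n → ℝ} (hx : IsOrbit A s x)
    (hx0 : ∀ i, 0 ≤ x s i) {J : Finset (Fin n)} {w δ : ℝ} (hw : 0 ≤ w) (hδ : 0 ≤ δ)
    (hJ : ∀ t, s ≤ t → t < b → ∀ i ∈ J, w ≤ x t i)
    (hcol : ∀ t, s ≤ t → t ≤ b → ∀ j, δ ≤ colSum (decouple A J) b t j) (hsb : s ≤ b) :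
    Real.exp (-((∑ τ ∈ Finset.Ico s b, cut (A τ) Jᶜ J) / γ)) *
      (δ * w * ∑ τ ∈ Finset.Ico s b, cut (A τ) Jᶜ J) ≤ ∑ j ∈ Jᶜ, x b j := by
  -- The potential weights `x t j` by the decoupled column sums, i.e. by how much of a unit at `j`
  -- survives until `b`. A step taking weight `u` from `J` adds at least `δ w u` and discounts the
  -- rest by at most `exp(-u/γ)`. At time `b` the weights are `1`.
  have key : ∀ t, s ≤ t → t ≤ b → Real.exp (-((∑ τ ∈ Finset.Ico s t, cut (A τ) Jᶜ J) / γ)) *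
      (δ * w * ∑ τ ∈ Finset.Ico s t, cut (A τ) Jᶜ J) ≤
        ∑ j ∈ Jᶜ, colSum (decouple A J) b t j * x t j := by
    intro t ht
    induction t, ht using Nat.le_induction with
    | base =>
      intro hb
      simp only [Finset.Ico_self, Finset.sum_empty, mul_zero]
      exact Finset.sum_nonneg fun j _ => mul_nonneg (hδ.trans (hcol s le_rfl hb j)) (hx0 j)
    | succ t ht ih =>
      intro hb
      have ih := ih (by omega)
      have hxt : ∀ i, 0 ≤ x t i := fun i => hx.le_of_le hA hx0 ht i
      rw [Finset.sum_Ico_succ_top ht]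
      set F := ∑ τ ∈ Finset.Ico s t, cut (A τ) Jᶜ J with hF
      set u := cut (A t) Jᶜ J with hu
      have hF0 : 0 ≤ F := Finset.sum_nonneg fun τ _ => cut_nonneg hA τ _ _
      have hu0 : 0 ≤ u := cut_nonneg hA t _ _
      have hρ : ∀ i, 0 ≤ colSum (decouple A J) b (t + 1) i :=
        fun i => hδ.trans (hcol (t + 1) (by omega) hb i)
      have h1 : ∑ i ∈ Jᶜ, colSum (decouple A J) b (t + 1) i * x (t + 1) i =
          (∑ i ∈ Jᶜ, ∑ j ∈ J, colSum (decouple A J) b (t + 1) i * (A t i j * x t j)) +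
          ∑ i ∈ Jᶜ, ∑ j ∈ Jᶜ, colSum (decouple A J) b (t + 1) i * (A t i j * x t j) := by
        rw [← Finset.sum_add_distrib]
        refine Finset.sum_congr rfl fun i _ => ?_
        rw [hx t ht, Finset.mul_sum, Finset.sum_add_sum_compl]
      have h2 : δ * w * u ≤
          ∑ i ∈ Jᶜ, ∑ j ∈ J, colSum (decouple A J) b (t + 1) i * (A t i j * x t j) := by
        rw [hu, cut, Finset.mul_sum]
        refine Finset.sum_le_sum fun i _ => ?_
        rw [Finset.mul_sum]
        refine Finset.sum_le_sum fun j hj => ?_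
        rw [mul_assoc, mul_comm w]
        exact mul_le_mul (hcol (t + 1) (by omega) hb i)
          (mul_le_mul_of_nonneg_left (hJ t ht (by omega) j hj) (hA.nonneg t i j))
          (mul_nonneg (hA.nonneg t i j) hw) (hρ i)
      have h3 : Real.exp (-(u / γ)) * ∑ j ∈ Jᶜ, colSum (decouple A J) b t j * x t j ≤
          ∑ i ∈ Jᶜ, ∑ j ∈ Jᶜ, colSum (decouple A J) b (t + 1) i * (A t i j * x t j) := by
        rw [Finset.sum_comm, Finset.mul_sum]
        refine Finset.sum_le_sum fun j hj => ?_
        have hj' : j ∉ J := Finset.mem_compl.1 hj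
        have h4 : colSum (decouple A J) b t j =
            ∑ i ∈ Jᶜ, colSum (decouple A J) b (t + 1) i * decouple A J t i j := by
          rw [colSum_eq _ (by omega), ← Finset.sum_compl_add_sum J, add_eq_left]
          exact Finset.sum_eq_zero fun i hi => by rw [decouple_eq_zero hi hj', mul_zero]
        rw [h4, Finset.sum_mul, Finset.mul_sum]
        refine Finset.sum_le_sum fun i hi => ?_
        have h5 := exp_mul_decouple_le hA hγ hdiag t (Finset.mem_compl.1 hi) hj'
        calc _ = colSum (decouple A J) b (t + 1) i *
              ((Real.exp (-(u / γ)) * decouple A J t i j) * x t j) := by ring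
          _ ≤ _ := mul_le_mul_of_nonneg_left
            (mul_le_mul_of_nonneg_right h5 (hxt j)) (hρ i)
      have h6 : Real.exp (-((F + u) / γ)) = Real.exp (-(u / γ)) * Real.exp (-(F / γ)) := by
        rw [← Real.exp_add]; ring_nf
      have h7 : Real.exp (-((F + u) / γ)) ≤ 1 := by
        rw [Real.exp_le_one_iff, neg_nonpos]; positivity
      have h8 := mul_le_mul_of_nonneg_left ih (Real.exp_pos (-(u / γ))).le
      have h9 : Real.exp (-((F + u) / γ)) * (δ * w * u) ≤ δ * w * u :=
        mul_le_of_le_one_left (by positivity) h7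
      rw [h1, mul_add (δ * w), mul_add]
      rw [← mul_assoc, ← h6] at h8
      linarith
  have := key b hsb le_rfl
  simpa [colSum, Matrix.one_apply] using this

/-- Off-diagonal entries vanish unless both indices are in `V`. -/
def ConfinedTo (A : ℕ → Matrix (Fin n) (Fin n) ℝ) (V : Finset (Fin n)) : Prop :=
  ∀ t i j, i ≠ j → ¬(i ∈ V ∧ j ∈ V) → A t i j = 0

/-- Freezing deactivates `k`; this is the descent in the outer induction on the number of active
indices. -/
lemma ConfinedTo.decouple {V : Finset (Fin n)} (h : ConfinedTo A V) {J : Finset (Fin n)} {k : Fin n}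
    (hk : k ∈ J) : ConfinedTo (decouple A J) (V.erase k) := by
  intro t i j hij hV
  simp only [StochasticChain.decouple, Matrix.of_apply, hij, if_false, add_zero]
  split_ifs with hi hj
  · rfl
  · rfl
  · refine h t i j hij fun hij' => hV ?_
    exact ⟨Finset.mem_erase.2 ⟨fun e => hi (e ▸ hk), hij'.1⟩,
      Finset.mem_erase.2 ⟨fun e => hj (e ▸ hk), hij'.2⟩⟩

lemma ConfinedTo.one_le_colSum (hA : IsStochasticChain A) {V : Finset (Fin n)}
    (h : ConfinedTo A V) {j : Fin n} (hj : j ∉ V) {s b : ℕ} (hsb : s ≤ b) : 1 ≤ colSum A b s j := by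
  have hjj : ∀ t, A t j j = 1 := fun t => by
    rw [← hA.sum_row t j, Finset.sum_eq_single j]
    · exact fun k _ hk => h t j k hk.symm fun h' => hj h'.1
    · simp
  have h1 : 1 ≤ backProd A b s j j := by
    induction b, hsb using Nat.le_induction with
    | base => simp
    | succ b hsb ih =>
      rw [backProd_succ A hsb, Matrix.mul_apply]
      refine ih.trans (le_trans ?_ (Finset.single_le_sum
        (fun k _ => mul_nonneg (hA.nonneg b j k) (hA.backProd_nonneg hsb k j))
        (Finset.mem_univ j)))
      rw [hjj, one_mul]
  exact h1.trans (Finset.single_le_sum (fun i _ => hA.backProd_nonneg hsb i j) (Finset.mem_univ j))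

/-- One growth step: either the weight entering `Jᶜ` stays below one, and `J` keeps its values, or
at some time an index outside `J` has acquired a comparable value. -/
lemma IsOrbit.stay_or_spread {γ p β C δ : ℝ} (hγ : 0 < γ) (hp : 0 < p) (hδ : 0 < δ)
    (hC : C = (1 + n + β) / p) (hA : IsStochasticChain A) (hdiag : ∀ t i, γ ≤ A t i i)
    {s b : ℕ} (hsb : s ≤ b) (hrec : ReciprocalOn A p β s b) {J : Finset (Fin n)} {j₀ : Fin n}
    (hj₀ : j₀ ∈ J)
    (hdec : ∀ s' b', s ≤ s' → s' ≤ b' → ReciprocalOn (decouple A J) p (β + C) s' b' →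
      ∀ j, δ ≤ colSum (decouple A J) b' s' j)
    {x : ℕ → Fin n → ℝ} (hx : IsOrbit A s x) (hx0 : ∀ i, 0 ≤ x s i) {v : ℝ} (hv : 0 ≤ v)
    (hJ : ∀ i ∈ J, v ≤ x s i) :
    Real.exp (-(C / γ)) * v ≤ ∑ i, x b i ∨
    ∃ s', s ≤ s' ∧ s' ≤ b ∧ ∃ k ∉ J, ∀ i ∈ insert k J,
      min (Real.exp (-(C / γ))) (Real.exp (-((1 + n) / γ)) * (δ * Real.exp (-(C / γ))) / n) * v
        ≤ x s' i := by
  have hn : (0 : ℝ) < n := by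
    have := j₀.pos
    exact_mod_cast this
  -- Reciprocity turns a bound `1 + n` on the weight taken from `J` into the bound `(1 + n + β)/p =
  -- C` on the weight that `J` takes from outside.
  have stay : ∀ t, s ≤ t → t ≤ b → ∑ τ ∈ Finset.Ico s t, cut (A τ) Jᶜ J ≤ 1 + n →
      ∀ i ∈ J, Real.exp (-(C / γ)) * v ≤ x t i := by
    intro t hst htb hin i hi
    refine le_trans ?_ (hx.le_on_set hA hγ hdiag hx0 hv hJ hst hi)
    have h1 := hrec J s t le_rfl hst htb
    rw [mul_comm]
    gcongr
    rw [hC, le_div_iff₀ hp]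
    linarith
  by_cases hin : ∑ τ ∈ Finset.Ico s b, cut (A τ) Jᶜ J < 1
  · left
    refine (stay b hsb le_rfl (by linarith) j₀ hj₀).trans ?_
    exact Finset.single_le_sum (fun i _ => hx.le_of_le hA hx0 hsb i) (Finset.mem_univ j₀)
  right
  have hex : ∃ t, s ≤ t ∧ 1 ≤ ∑ τ ∈ Finset.Ico s t, cut (A τ) Jᶜ J := ⟨b, hsb, not_lt.1 hin⟩
  classical
  obtain ⟨s', ⟨hss', hs'1⟩, hmin⟩ : ∃ s', (s ≤ s' ∧ 1 ≤ ∑ τ ∈ Finset.Ico s s', cut (A τ) Jᶜ J) ∧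
      ∀ t < s', ¬ (s ≤ t ∧ 1 ≤ ∑ τ ∈ Finset.Ico s t, cut (A τ) Jᶜ J) :=
    ⟨Nat.find hex, Nat.find_spec hex, fun t ht => Nat.find_min hex ht⟩
  have hs'b : s' ≤ b := by
    by_contra h
    exact hmin b (by omega) ⟨hsb, not_lt.1 hin⟩
  have hne : s ≠ s' := by
    rintro rfl
    norm_num at hs'1
  obtain ⟨r, rfl⟩ : ∃ r, s' = r + 1 := ⟨s' - 1, by omega⟩
  -- At the first time the sum reaches `1`, it overshoots by at most one step's total weight `n`.
  have hs'2 : ∑ τ ∈ Finset.Ico s (r + 1), cut (A τ) Jᶜ J ≤ 1 + n := by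
    have h1 := hmin r (by omega)
    rw [Finset.sum_Ico_succ_top (by omega)]
    have h2 := cut_le hA r Jᶜ J
    by_contra h3
    exact h1 ⟨by omega, by linarith⟩
  have hle : ∀ t, t ≤ r + 1 → ∑ τ ∈ Finset.Ico s t, cut (A τ) Jᶜ J ≤ 1 + n := fun t ht =>
    (Finset.sum_le_sum_of_subset_of_nonneg (Finset.Ico_subset_Ico le_rfl ht)
      fun τ _ _ => cut_nonneg hA τ _ _).trans hs'2
  have hout : ∑ τ ∈ Finset.Ico s (r + 1), cut (A τ) J Jᶜ ≤ C := by
    have h1 := hrec J s (r + 1) le_rfl hss' hs'b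
    rw [hC, le_div_iff₀ hp]
    linarith
  have hrec' := ReciprocalOn.decouple hA hp.le (hrec.mono le_rfl hs'b) hout
  have hsum := hx.le_sum_compl hA hγ hdiag hx0 (J := J) (w := Real.exp (-(C / γ)) * v)
    (by positivity) hδ.le
    (fun t h1 h2 i hi => stay t h1 (by omega) (hle t (by omega)) i hi)
    (fun t h1 h2 => hdec t (r + 1) h1 h2 (hrec'.mono h1 le_rfl)) hss'
  set F := ∑ τ ∈ Finset.Ico s (r + 1), cut (A τ) Jᶜ J with hF
  have hq : Real.exp (-((1 + n) / γ)) * (δ * Real.exp (-(C / γ))) * v ≤ ∑ j ∈ Jᶜ, x (r + 1) j := by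
    refine le_trans ?_ hsum
    calc _ = Real.exp (-((1 + n) / γ)) * (δ * (Real.exp (-(C / γ)) * v) * 1) := by ring
      _ ≤ _ := by gcongr
  have hJne : Jᶜ.Nonempty := by
    rw [Finset.nonempty_iff_ne_empty]
    intro h
    simp [hF, cut, h] at hs'1
    norm_num at hs'1
  obtain ⟨k, hk, hkx⟩ : ∃ k ∈ Jᶜ,
      Real.exp (-((1 + n) / γ)) * (δ * Real.exp (-(C / γ))) / n * v ≤ x (r + 1) k := by
    refine Finset.exists_le_of_sum_le hJne (le_trans ?_ hq)
    have hcard : (Jᶜ.card : ℝ) ≤ n := by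
      have := Finset.card_le_univ Jᶜ
      rw [Fintype.card_fin] at this
      exact_mod_cast this
    rw [Finset.sum_const, nsmul_eq_mul, div_mul_eq_mul_div, mul_div_assoc', div_le_iff₀ hn, mul_comm]
    gcongr
  refine ⟨r + 1, hss', hs'b, k, Finset.mem_compl.1 hk, fun i hi => ?_⟩
  rcases Finset.mem_insert.1 hi with rfl | hi
  · exact (mul_le_mul_of_nonneg_right (min_le_right _ _) hv).trans hkx
  · exact (mul_le_mul_of_nonneg_right (min_le_left _ _) hv).trans (stay _ hss' hs'b hs'2 i hi)

/-- The column sums of the products of an aperiodic, approximately reciprocal chain are bounded from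
below by a constant that depends only on the parameters. -/
theorem exists_le_colSum_of_confined (n : ℕ) {γ p : ℝ} (hγ : 0 < γ) (hp : 0 < p) (m : ℕ) :
    ∀ β : ℝ, 0 ≤ β → ∃ δ : ℝ, 0 < δ ∧ ∀ A : ℕ → Matrix (Fin n) (Fin n) ℝ, IsStochasticChain A →
      (∀ t i, γ ≤ A t i i) → ∀ V : Finset (Fin n), V.card ≤ m → ConfinedTo A V →
      ∀ s b, s ≤ b → ReciprocalOn A p β s b → ∀ j, δ ≤ colSum A b s j := by
  -- `β` stays quantified inside the induction, because freezing a set raises it to `β + C`.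
  induction m with
  | zero =>
    intro β _
    refine ⟨1, one_pos, fun A hA _ V hV hAV s b hsb _ j => hAV.one_le_colSum hA ?_ hsb⟩
    rw [Finset.card_eq_zero.1 (Nat.le_zero.1 hV)]
    exact Finset.notMem_empty j
  | succ m ih =>
    intro β hβ
    set C : ℝ := (1 + n + β) / p with hC
    have hC0 : 0 ≤ C := by positivity
    obtain ⟨δ', hδ', ih⟩ := ih (β + C) (by positivity)
    -- Second induction, on the size of `Jᶜ`: each spreading step enlarges `J`, at the cost of the
    -- factor `c` below. The index `j₀ ∈ V ∩ J` guarantees that freezing `J` shrinks `V`.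
    have inner : ∀ k : ℕ, ∃ δ : ℝ, 0 < δ ∧ ∀ A : ℕ → Matrix (Fin n) (Fin n) ℝ,
        IsStochasticChain A → (∀ t i, γ ≤ A t i i) → ∀ V : Finset (Fin n), V.card ≤ m + 1 →
        ConfinedTo A V → ∀ s b, s ≤ b → ReciprocalOn A p β s b →
        ∀ x, IsOrbit A s x → (∀ i, 0 ≤ x s i) → ∀ j₀ ∈ V, ∀ J : Finset (Fin n), j₀ ∈ J →
        Jᶜ.card ≤ k → ∀ v, 0 ≤ v → (∀ i ∈ J, v ≤ x s i) → δ * v ≤ ∑ i, x b i := by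
      intro k
      induction k with
      | zero =>
        refine ⟨1, one_pos, ?_⟩
        intro A hA _ V _ _ s b hsb _ x hx hx0 j₀ _ J _ hJ v _ hv
        have hJ' : ∀ i, i ∈ J := by
          intro i
          by_contra hi
          have := Finset.card_pos.2 ⟨i, Finset.mem_compl.2 hi⟩
          omega
        rw [one_mul]
        refine (hx.le_of_le hA (fun i => hv i (hJ' i)) hsb j₀).trans ?_
        exact Finset.single_le_sum (fun i _ => hx.le_of_le hA hx0 hsb i) (Finset.mem_univ j₀)
      | succ k ihk =>
        obtain ⟨δ, hδ, ihk⟩ := ihk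
        rcases Nat.eq_zero_or_pos n with hn | hn
        · subst hn
          exact ⟨1, one_pos, fun _ _ _ _ _ _ _ _ _ _ _ _ _ j₀ => j₀.elim0⟩
        set c : ℝ := min (Real.exp (-(C / γ)))
          (Real.exp (-((1 + n) / γ)) * (δ' * Real.exp (-(C / γ))) / n) with hc
        have hn' : (0 : ℝ) < n := by exact_mod_cast hn
        have hc0 : 0 < c := by positivity
        refine ⟨min (Real.exp (-(C / γ))) (δ * c), by positivity, ?_⟩
        intro A hA hdiag V hV hAV s b hsb hrec x hx hx0 j₀ hj₀ J hj₀J hJ v hv hJv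
        have hγ1 : γ ≤ 1 := (hdiag 0 j₀).trans (hA.le_one 0 j₀ j₀)
        have hcard : (V.erase j₀).card ≤ m := by
          rw [Finset.card_erase_of_mem hj₀]; omega
        rcases hx.stay_or_spread hγ hp hδ' hC hA hdiag hsb hrec hj₀J
          (fun s' b' _ h h' => ih _ (hA.decouple J) (le_decouple_diag hA hγ1 hdiag J) _ hcard
            (hAV.decouple hj₀J) s' b' h h') hx0 hv hJv with h | ⟨s', hss', hs'b, i, hi, h⟩
        · exact (mul_le_mul_of_nonneg_right (min_le_left _ _) hv).trans h
        · refine (mul_le_mul_of_nonneg_right (min_le_right _ _) hv).trans ?_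
          rw [mul_assoc]
          refine ihk A hA hdiag V hV hAV s' b hs'b (hrec.mono hss' le_rfl) x (hx.mono hss')
            (hx.le_of_le hA hx0 hss') j₀ hj₀ (insert i J) (Finset.mem_insert_of_mem hj₀J) ?_
            (c * v) (by positivity) h
          rw [Finset.compl_insert, Finset.card_erase_of_mem (Finset.mem_compl.2 hi)]
          omega
    obtain ⟨δ, hδ, inner⟩ := inner n
    refine ⟨min 1 δ, by positivity, ?_⟩
    intro A hA hdiag V hV hAV s b hsb hrec j
    by_cases hj : j ∈ V
    · refine (min_le_right _ _).trans ?_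
      have := inner A hA hdiag V hV hAV s b hsb hrec _ (isOrbit_backProd_col A s j)
        (hA.backProd_nonneg le_rfl · j) j hj {j} (Finset.mem_singleton_self j)
        ((Finset.card_le_univ _).trans_eq (Fintype.card_fin n)) 1 zero_le_one (by simp)
      simpa [colSum] using this
    · exact (min_le_left _ _).trans (hAV.one_le_colSum hA hj hsb)

/-- The column sums of the products `A(b : s)` are bounded away from zero. -/
theorem exists_le_colSum (hA : IsStochasticChain A) (hap : StronglyAperiodic A)
    (hrec : ApproximatelyReciprocal A) :
    ∃ δ : ℝ, 0 < δ ∧ ∀ s b, s ≤ b → ∀ j, δ ≤ colSum A b s j := by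
  obtain ⟨γ, hγ, hdiag⟩ := hap
  obtain ⟨p, β, hp, hβ, h⟩ := hrec
  obtain ⟨δ, hδ, hcol⟩ := exists_le_colSum_of_confined n hγ hp n β hβ.le
  refine ⟨δ, hδ, fun s b hsb => hcol A hA hdiag Finset.univ (by simp) (fun _ _ _ _ h' => ?_) s b hsb
    fun S t₀ t₁ _ h₁ _ => ?_⟩
  · simp at h'
  · rcases h₁.lt_or_eq with h₁ | rfl
    · exact h S t₀ t₁ h₁
    · simpa using hβ.le

/-! ### Sums of nonnegative terms over time windows -/

lemma exists_forall_sum_Ico_lt {g : ℕ → ℝ} (hg : Summable g) {κ : ℝ} (hκ : 0 < κ) :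
    ∃ N, ∀ t, N ≤ t → ∀ τ, ∑ r ∈ Finset.Ico t τ, g r < κ := by
  obtain ⟨s, hs⟩ := summable_iff_vanishing_norm.1 hg κ hκ
  refine ⟨s.sup id + 1, fun t ht τ => (le_abs_self _).trans_lt (hs _ ?_)⟩
  rw [Finset.disjoint_left]
  intro r hr hrs
  have h1 : r ≤ s.sup id := Finset.le_sup (f := id) hrs
  have h2 := (Finset.mem_Ico.1 hr).1
  omega

lemma summable_of_sum_Ico_le {g : ℕ → ℝ} (hg : ∀ t, 0 ≤ g t) {s : ℕ} {K : ℝ}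
    (h : ∀ b, s ≤ b → ∑ t ∈ Finset.Ico s b, g t ≤ K) : Summable g := by
  rw [← summable_nat_add_iff s]
  refine summable_of_sum_range_le (c := K) (fun t => hg _) fun m => ?_
  have := h (s + m) (Nat.le_add_right s m)
  rw [Finset.sum_Ico_eq_sum_range, Nat.add_sub_cancel_left] at this
  simpa only [add_comm] using this

lemma exists_lt_sum_Ico {g : ℕ → ℝ} (hg : ∀ t, 0 ≤ g t) (h : ¬ Summable g) (s : ℕ) (K : ℝ) :
    ∃ b, s ≤ b ∧ K < ∑ t ∈ Finset.Ico s b, g t := by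
  by_contra! h'
  exact h (summable_of_sum_Ico_le hg h')

/-! ### Energy dissipation -/

/-- The interaction-weighted dispersion of the vector `x`. -/
def dispersion (M : Matrix (Fin n) (Fin n) ℝ) (x : Fin n → ℝ) : ℝ :=
  ∑ i, ∑ j, M i j * (x i - x j) ^ 2

lemma dispersion_nonneg (hA : IsStochasticChain A) (t : ℕ) (x : Fin n → ℝ) :
    0 ≤ dispersion (A t) x :=
  Finset.sum_nonneg fun i _ => Finset.sum_nonneg fun j _ =>
    mul_nonneg (hA.nonneg t i j) (sq_nonneg _)

/-- With `V` the second moment about `x i` and `μ` the mean, the variance is `V - (x i - μ)²`. The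
term `j = i` drops out of `x i - μ`, so Cauchy–Schwarz bounds its square by `(1 - a i) V`, leaving
at least `a i V`. -/
lemma variance_row_ge {a x : Fin n → ℝ} {γ : ℝ} (ha : ∀ j, 0 ≤ a j) (hsum : ∑ j, a j = 1)
    (i : Fin n) (hi : γ ≤ a i) :
    γ * ∑ j, a j * (x i - x j) ^ 2 ≤ ∑ j, a j * x j ^ 2 - (∑ j, a j * x j) ^ 2 := by
  set V := ∑ j, a j * (x i - x j) ^ 2 with hV
  have hV0 : 0 ≤ V := Finset.sum_nonneg fun j _ => mul_nonneg (ha j) (sq_nonneg _)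
  set μ := ∑ j, a j * x j with hμ
  have h1 : ∑ j, a j * x j ^ 2 = V - x i ^ 2 + 2 * x i * μ := by
    have : V = ∑ j, (a j * x i ^ 2 - 2 * x i * (a j * x j) + a j * x j ^ 2) :=
      Finset.sum_congr rfl fun j _ => by ring
    rw [this, Finset.sum_add_distrib, Finset.sum_sub_distrib, ← Finset.sum_mul, hsum,
      ← Finset.mul_sum]
    ring
  have h2 : x i - μ = ∑ j ∈ Finset.univ.erase i, a j * (x i - x j) := by
    have h3 : x i - μ = ∑ j, a j * (x i - x j) := by
      simp only [mul_sub, Finset.sum_sub_distrib, ← Finset.sum_mul, hsum, one_mul, hμ]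
    rw [h3, ← Finset.add_sum_erase _ _ (Finset.mem_univ i)]
    simp
  have h4 : (x i - μ) ^ 2 ≤ (∑ j ∈ Finset.univ.erase i, a j) *
      ∑ j ∈ Finset.univ.erase i, a j * (x i - x j) ^ 2 := by
    rw [h2]
    exact Finset.sum_sq_le_sum_mul_sum_of_sq_le_mul _ (fun j _ => ha j)
      (fun j _ => mul_nonneg (ha j) (sq_nonneg _)) (fun j _ => le_of_eq (by ring))
  have h5 : ∑ j ∈ Finset.univ.erase i, a j = 1 - a i := by
    rw [← hsum, ← Finset.add_sum_erase _ _ (Finset.mem_univ i)]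
    ring
  have h6 : ∑ j ∈ Finset.univ.erase i, a j * (x i - x j) ^ 2 = V := by
    rw [hV, ← Finset.add_sum_erase _ _ (Finset.mem_univ i)]
    simp
  rw [h5, h6] at h4
  have h7 : γ * V ≤ a i * V := mul_le_mul_of_nonneg_right hi hV0
  rw [h1]
  linarith

lemma sum_colSum (hA : IsStochasticChain A) {s b : ℕ} (h : s ≤ b) : ∑ j, colSum A b s j = n := by
  simp only [colSum]
  rw [Finset.sum_comm]
  simp [hA.backProd_sum_row h]

/-- For a fixed horizon `b`, the energy `∑ colSum A b t j * x t j ^ 2` decreases by the weighted sum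
of the row variances, because the column sums satisfy the backward recursion. Its initial value is
bounded independently of `b`. -/
lemma IsOrbit.summable_dispersion (hA : IsStochasticChain A) {γ δ : ℝ} (hγ : 0 < γ)
    (hdiag : ∀ t i, γ ≤ A t i i) (hδ : 0 < δ) (hcol : ∀ s b, s ≤ b → ∀ j, δ ≤ colSum A b s j)
    {s : ℕ} {x : ℕ → Fin n → ℝ} (hx : IsOrbit A s x) :
    Summable fun t => dispersion (A t) (x t) := by
  refine summable_of_sum_Ico_le (fun t => dispersion_nonneg hA t _) (s := s)
    (K := (δ * γ)⁻¹ * (n * ∑ i, x s i ^ 2)) fun b hsb => ?_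
  rw [← div_eq_inv_mul, le_div_iff₀ (by positivity)]
  have step : ∀ t, s ≤ t → t < b → δ * γ * dispersion (A t) (x t) ≤
      ∑ j, colSum A b t j * x t j ^ 2 - ∑ i, colSum A b (t + 1) i * x (t + 1) i ^ 2 := by
    intro t ht htb
    have h1 : ∑ j, colSum A b t j * x t j ^ 2 =
        ∑ i, colSum A b (t + 1) i * ∑ j, A t i j * x t j ^ 2 := by
      simp only [colSum_eq A htb, Finset.sum_mul, Finset.mul_sum]
      rw [Finset.sum_comm]
      simp only [mul_assoc]
    rw [h1, ← Finset.sum_sub_distrib, dispersion, Finset.mul_sum]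
    refine Finset.sum_le_sum fun i _ => ?_
    have h2 := variance_row_ge (x := x t) (hA.nonneg t i) (hA.sum_row t i) i (hdiag t i)
    have h3 : 0 ≤ γ * ∑ j, A t i j * (x t i - x t j) ^ 2 :=
      mul_nonneg hγ.le (Finset.sum_nonneg fun j _ => mul_nonneg (hA.nonneg t i j) (sq_nonneg _))
    rw [hx t ht, ← mul_sub, mul_assoc]
    exact mul_le_mul (hcol (t + 1) b htb i) h2 h3 (hδ.le.trans (hcol (t + 1) b htb i))
  have tele : ∀ t, s ≤ t → t ≤ b → (∑ τ ∈ Finset.Ico s t, dispersion (A τ) (x τ)) * (δ * γ) ≤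
      ∑ j, colSum A b s j * x s j ^ 2 - ∑ i, colSum A b t i * x t i ^ 2 := by
    intro t ht
    induction t, ht using Nat.le_induction with
    | base => simp
    | succ t ht ih =>
      intro htb
      rw [Finset.sum_Ico_succ_top ht, add_mul]
      linarith [ih (by omega), step t ht (by omega)]
  refine (tele b hsb le_rfl).trans ?_
  have h1 : 0 ≤ ∑ i, colSum A b b i * x b i ^ 2 := Finset.sum_nonneg fun i _ =>
    mul_nonneg (hδ.le.trans (hcol b b le_rfl i)) (sq_nonneg _)
  have h2 : ∑ j, colSum A b s j * x s j ^ 2 ≤ n * ∑ j, x s j ^ 2 := by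
    rw [Finset.mul_sum]
    refine Finset.sum_le_sum fun j _ => mul_le_mul_of_nonneg_right ?_ (sq_nonneg _)
    rw [← sum_colSum hA hsb]
    exact Finset.single_le_sum (fun j _ => hδ.le.trans (hcol s b hsb j)) (Finset.mem_univ j)
  linarith

/-! ### Consensus on weakly coupled, internally connected sets -/

/-- Only weight placed outside `S` can lower the minimum over `S`, and a unit of it lowers it by at
most the diameter `2M` of the range. -/
lemma IsOrbit.sub_le_on_set (hA : IsStochasticChain A) {s : ℕ} {x : ℕ → Fin n → ℝ}
    (hx : IsOrbit A s x) {M : ℝ} (hM : ∀ t, s ≤ t → ∀ i, |x t i| ≤ M) {S : Finset (Fin n)} {m : ℝ}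
    {t₀ : ℕ} (hs : s ≤ t₀) (hm : ∀ i ∈ S, m ≤ x t₀ i) {t : ℕ} (ht : t₀ ≤ t) {i : Fin n}
    (hi : i ∈ S) : m - 2 * M * ∑ τ ∈ Finset.Ico t₀ t, cut (A τ) S Sᶜ ≤ x t i := by
  have hM0 : 0 ≤ M := (abs_nonneg _).trans (hM s le_rfl i)
  induction t, ht using Nat.le_induction generalizing i with
  | base => simpa using hm i hi
  | succ t ht ih =>
    rw [Finset.sum_Ico_succ_top ht]
    set w := m - 2 * M * ∑ τ ∈ Finset.Ico t₀ t, cut (A τ) S Sᶜ with hw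
    have hwM : w ≤ M := (ih hi).trans (abs_le.1 (hM t (hs.trans ht) i)).2
    have h1 : x (t + 1) i - w = ∑ j ∈ S, A t i j * (x t j - w) + ∑ j ∈ Sᶜ, A t i j * (x t j - w) := by
      rw [Finset.sum_add_sum_compl, hx t (hs.trans ht)]
      simp only [mul_sub, Finset.sum_sub_distrib, ← Finset.sum_mul, hA.sum_row, one_mul]
    have h2 : 0 ≤ ∑ j ∈ S, A t i j * (x t j - w) := Finset.sum_nonneg fun j hj =>
      mul_nonneg (hA.nonneg t i j) (sub_nonneg.2 (ih hj))
    have h3 : -(2 * M * ∑ j ∈ Sᶜ, A t i j) ≤ ∑ j ∈ Sᶜ, A t i j * (x t j - w) := by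
      rw [Finset.mul_sum, ← Finset.sum_neg_distrib]
      refine Finset.sum_le_sum fun j _ => ?_
      have := (abs_le.1 (hM t (hs.trans ht) j)).1
      nlinarith [hA.nonneg t i j]
    have h4 : 2 * M * ∑ j ∈ Sᶜ, A t i j ≤ 2 * M * cut (A t) S Sᶜ :=
      mul_le_mul_of_nonneg_left (sum_le_cut hA t hi) (by positivity)
    have h5 : m - 2 * M * (∑ τ ∈ Finset.Ico t₀ t, cut (A τ) S Sᶜ + cut (A t) S Sᶜ) =
        w - 2 * M * cut (A t) S Sᶜ := by rw [hw]; ring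
    linarith

/-- Without a gap, raising the level from `f i₂` in steps of `d` adds a new index of `C` to the
sublevel set each time, as `i₁` is not yet reached; `n` steps would give `n + 1` indices. -/
lemma exists_gap (C : Finset (Fin n)) (f : Fin n → ℝ) {d : ℝ} {i₁ i₂ : Fin n}
    (h₁ : i₁ ∈ C) (h₂ : i₂ ∈ C) (hd : 0 < d) (h : f i₂ + n * d ≤ f i₁) :
    ∃ S ⊆ C, S.Nonempty ∧ (C \ S).Nonempty ∧ ∀ i ∈ S, ∀ j ∈ C \ S, f i + d ≤ f j := by
  by_contra! hno
  have key : ∀ k : ℕ, k ≤ n → k + 1 ≤ (C.filter fun i => f i ≤ f i₂ + k * d).card := by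
    intro k
    induction k with
    | zero =>
      intro _
      exact Finset.card_pos.2 ⟨i₂, by simp [h₂]⟩
    | succ k ih =>
      intro hk
      have hkn : (k : ℝ) + 1 ≤ n := by exact_mod_cast hk
      obtain ⟨i, hi, j, hj, hij⟩ := hno (C.filter fun i => f i ≤ f i₂ + k * d)
        (Finset.filter_subset _ _) ⟨i₂, by simp [h₂]; positivity⟩
        ⟨i₁, by simp only [Finset.mem_sdiff, Finset.mem_filter, h₁, true_and, not_le]; nlinarith⟩
      rw [Finset.mem_filter] at hi
      rw [Finset.mem_sdiff] at hj
      refine (Nat.succ_le_succ (ih (by omega))).trans (Finset.card_lt_card ?_)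
      rw [Finset.ssubset_iff_of_subset]
      · refine ⟨j, Finset.mem_filter.2 ⟨hj.1, ?_⟩, hj.2⟩
        push_cast
        linarith [hi.2]
      · intro l hl
        rw [Finset.mem_filter] at hl ⊢
        refine ⟨hl.1, ?_⟩
        push_cast
        linarith [hl.2]
  have h1 := key n le_rfl
  have h2 := Finset.card_le_univ (C.filter fun i => f i ≤ f i₂ + n * d)
  rw [Fintype.card_fin] at h2
  omega

lemma cut_mul_le_dispersion (hA : IsStochasticChain A) {t : ℕ} {x : Fin n → ℝ}
    {S H : Finset (Fin n)} (hSH : Disjoint S H) {d : ℝ} (hd : 0 ≤ d)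
    (h : ∀ i ∈ S, ∀ j ∈ H, x i + d ≤ x j) :
    (cut (A t) S H + cut (A t) H S) * d ^ 2 ≤ dispersion (A t) x := by
  simp only [cut_eq_sum_ite, dispersion, ← Finset.sum_add_distrib, Finset.sum_mul]
  refine Finset.sum_le_sum fun i _ => Finset.sum_le_sum fun j _ => ?_
  have h0 := hA.nonneg t i j
  have hnn : 0 ≤ A t i j * (x i - x j) ^ 2 := mul_nonneg h0 (sq_nonneg _)
  by_cases h1 : i ∈ S ∧ j ∈ H
  · have h2 : ¬(i ∈ H ∧ j ∈ S) := fun h3 => Finset.disjoint_left.1 hSH h1.1 h3.1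
    rw [if_pos h1, if_neg h2, add_zero]
    refine mul_le_mul_of_nonneg_left ?_ h0
    nlinarith [h i h1.1 j h1.2]
  · rw [if_neg h1, zero_add]
    split_ifs with h2
    · refine mul_le_mul_of_nonneg_left ?_ h0
      nlinarith [h j h2.2 i h2.1]
    · simpa using hnn

lemma cut_union_right (M : Matrix (Fin n) (Fin n) ℝ) (S : Finset (Fin n)) {T U : Finset (Fin n)}
    (h : Disjoint T U) : cut M S (T ∪ U) = cut M S T + cut M S U := by
  simp only [cut, Finset.sum_union h, Finset.sum_add_distrib]

lemma cut_mono (hA : IsStochasticChain A) (t : ℕ) {S S' T T' : Finset (Fin n)} (hS : S ⊆ S')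
    (hT : T ⊆ T') : cut (A t) S T ≤ cut (A t) S' T' := by
  refine (Finset.sum_le_sum fun i _ => Finset.sum_le_sum_of_subset_of_nonneg hT
    fun j _ _ => hA.nonneg t i j).trans ?_
  exact Finset.sum_le_sum_of_subset_of_nonneg hS
    fun i _ _ => Finset.sum_nonneg fun j _ => hA.nonneg t i j

lemma cut_compl_le (hA : IsStochasticChain A) (t : ℕ) {S H C : Finset (Fin n)} (hS : S ⊆ C)
    (hC : C ⊆ S ∪ H) : cut (A t) S Sᶜ ≤ cut (A t) S H + cut (A t) C Cᶜ := by
  have h1 : cut (A t) S Sᶜ ≤ cut (A t) S (H ∩ C ∪ Cᶜ) := by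
    refine cut_mono hA t subset_rfl fun i hi => ?_
    by_cases hiC : i ∈ C
    · have := (Finset.mem_union.1 (hC hiC)).resolve_left (Finset.mem_compl.1 hi)
      exact Finset.mem_union_left _ (Finset.mem_inter.2 ⟨this, hiC⟩)
    · exact Finset.mem_union_right _ (Finset.mem_compl.2 hiC)
  have h2 : Disjoint (H ∩ C) Cᶜ := by
    rw [Finset.disjoint_left]
    intro i hi hi'
    exact Finset.mem_compl.1 hi' (Finset.mem_inter.1 hi).2
  rw [cut_union_right _ _ h2] at h1
  exact h1.trans (add_le_add (cut_mono hA t subset_rfl Finset.inter_subset_left)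
    (cut_mono hA t hS subset_rfl))

/-- The values on `C` come arbitrarily close to each other at late times. -/
lemma IsOrbit.exists_close (hA : IsStochasticChain A) {s : ℕ} {x : ℕ → Fin n → ℝ}
    (hx : IsOrbit A s x) {M : ℝ} (hM0 : 0 < M) (hM : ∀ t, s ≤ t → ∀ i, |x t i| ≤ M)
    (hdisp : Summable fun t => dispersion (A t) (x t)) {C : Finset (Fin n)}
    (hout : Summable fun t => cut (A t) C Cᶜ)
    (hconn : ∀ S ⊆ C, S.Nonempty → (C \ S).Nonempty →
      ¬ Summable fun t => cut (A t) S (C \ S) + cut (A t) (C \ S) S)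
    {ε : ℝ} (hε : 0 < ε) (T : ℕ) :
    ∃ t, T ≤ t ∧ ∀ i ∈ C, ∀ j ∈ C, x t i - x t j < ε := by
  by_contra! hno
  have hn : (0 : ℝ) < n := by
    obtain ⟨i, -⟩ := hno T le_rfl
    exact_mod_cast i.pos
  set d : ℝ := ε / n with hd
  have hd0 : 0 < d := by positivity
  -- Until flow `q` has crossed between `S` and `H`, each takes weight at most `2q` from outside, so
  -- its extreme value drifts by at most `2M · 2q = d/4`. The gap `d` thus stays above `d/2`.
  set q : ℝ := d / (16 * M) with hq
  have hq0 : 0 < q := by positivity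
  obtain ⟨N₁, hN₁⟩ := exists_forall_sum_Ico_lt hout hq0
  obtain ⟨N₂, hN₂⟩ := exists_forall_sum_Ico_lt hdisp (κ := q * (d / 2) ^ 2) (by positivity)
  set t₀ := max (max s T) (max N₁ N₂) with ht₀
  obtain ⟨i₁, hi₁, i₂, hi₂, h12⟩ := hno t₀ (by omega)
  obtain ⟨S, hSC, hSne, hHne, hgap⟩ := exists_gap C (x t₀) hi₁ hi₂ hd0
    (by rw [hd, mul_div_cancel₀ _ hn.ne']; linarith)
  set H := C \ S with hH
  have hdis : Disjoint S H := Finset.disjoint_sdiff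
  set f : ℕ → ℝ := fun t => cut (A t) S H + cut (A t) H S with hf
  have hf0 : ∀ t, 0 ≤ f t := fun t => add_nonneg (cut_nonneg hA t _ _) (cut_nonneg hA t _ _)
  have hex : ∃ b, t₀ ≤ b ∧ q < ∑ t ∈ Finset.Ico t₀ b, f t :=
    exists_lt_sum_Ico hf0 (hconn S hSC hSne hHne) t₀ q
  classical
  obtain ⟨b, ⟨hb, hbq⟩, hmin⟩ : ∃ b, (t₀ ≤ b ∧ q < ∑ t ∈ Finset.Ico t₀ b, f t) ∧
      ∀ t < b, ¬ (t₀ ≤ t ∧ q < ∑ t ∈ Finset.Ico t₀ t, f t) :=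
    ⟨Nat.find hex, Nat.find_spec hex, fun t ht => Nat.find_min hex ht⟩
  have hgap' : ∀ t, t₀ ≤ t → t < b → ∀ i ∈ S, ∀ j ∈ H, x t i + d / 2 ≤ x t j := by
    intro t ht htb i hi j hj
    have hF : ∑ τ ∈ Finset.Ico t₀ t, f τ ≤ q := by
      by_contra h
      exact hmin t htb ⟨ht, not_le.1 h⟩
    have hE : ∑ τ ∈ Finset.Ico t₀ t, cut (A τ) C Cᶜ < q := hN₁ t₀ (by omega) t
    have hbd : ∀ S' : Finset (Fin n), (∀ τ, cut (A τ) S' S'ᶜ ≤ f τ + cut (A τ) C Cᶜ) →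
        2 * M * ∑ τ ∈ Finset.Ico t₀ t, cut (A τ) S' S'ᶜ ≤ d / 4 := by
      intro S' hS'
      have h1 : ∑ τ ∈ Finset.Ico t₀ t, cut (A τ) S' S'ᶜ ≤ 2 * q := by
        refine (Finset.sum_le_sum fun τ _ => hS' τ).trans ?_
        rw [Finset.sum_add_distrib]
        linarith
      refine (mul_le_mul_of_nonneg_left h1 (by positivity)).trans_eq ?_
      rw [hq]
      field_simp
      norm_num
    have hbS := hbd S fun τ => by
      have h1 := cut_compl_le hA τ (H := H) hSC (by rw [hH, Finset.union_sdiff_of_subset hSC])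
      have h2 := cut_nonneg hA τ H S
      simp only [hf]
      linarith
    have hbH := hbd H fun τ => by
      have h1 := cut_compl_le hA τ (S := H) (H := S) (C := C) Finset.sdiff_subset
        (by rw [hH, Finset.sdiff_union_of_subset hSC])
      have h2 := cut_nonneg hA τ S H
      simp only [hf]
      linarith
    obtain ⟨l, hl, hlmax⟩ := S.exists_max_image (x t₀) hSne
    have hlow := hx.neg.sub_le_on_set hA (M := M)
      (fun t ht i => by rw [abs_neg]; exact hM t ht i) (t₀ := t₀) (by omega) (m := -(x t₀ l))
      (fun i hi => neg_le_neg (hlmax i hi)) ht hi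
    have hhigh := hx.sub_le_on_set hA hM (t₀ := t₀) (by omega) (m := x t₀ l + d)
      (fun j hj => hgap l hl j hj) ht hj
    linarith
  -- Crossing flow above `q` against a gap of `d/2` dissipates at least `q (d/2)²`, more than the
  -- tail allows.
  have hlt := hN₂ t₀ (by omega) b
  have hge : (∑ t ∈ Finset.Ico t₀ b, f t) * (d / 2) ^ 2 ≤
      ∑ t ∈ Finset.Ico t₀ b, dispersion (A t) (x t) := by
    rw [Finset.sum_mul]
    refine Finset.sum_le_sum fun t ht => ?_
    rw [Finset.mem_Ico] at ht
    exact cut_mul_le_dispersion hA hdis (by positivity) (hgap' t ht.1 ht.2)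
  have : q * (d / 2) ^ 2 ≤ (∑ t ∈ Finset.Ico t₀ b, f t) * (d / 2) ^ 2 := by gcongr
  linarith

/-- Once the values on `C` are close at a single late time, the small remaining outside weight traps
them in a narrow band forever. -/
theorem IsOrbit.exists_tendsto (hA : IsStochasticChain A) {s : ℕ} {x : ℕ → Fin n → ℝ}
    (hx : IsOrbit A s x)
    (hdisp : Summable fun t => dispersion (A t) (x t)) {C : Finset (Fin n)}
    (hout : Summable fun t => cut (A t) C Cᶜ)
    (hconn : ∀ S ⊆ C, S.Nonempty → (C \ S).Nonempty →
      ¬ Summable fun t => cut (A t) S (C \ S) + cut (A t) (C \ S) S) :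
    ∃ L, ∀ i ∈ C, Tendsto (fun t => x t i) atTop (𝓝 L) := by
  rcases C.eq_empty_or_nonempty with rfl | ⟨i₀, hi₀⟩
  · exact ⟨0, by simp⟩
  set M : ℝ := 1 + ∑ i, |x s i| with hMdef
  have hM0 : 0 < M := by positivity
  have hM : ∀ t, s ≤ t → ∀ i, |x t i| ≤ M := fun t ht i => by
    refine hx.abs_apply_le hA (fun j => ?_) ht i
    have := Finset.single_le_sum (f := fun i => |x s i|) (fun i _ => abs_nonneg _)
      (Finset.mem_univ j)
    linarith
  have band : ∀ ε : ℝ, 0 < ε → ∃ T, s ≤ T ∧ ∃ c, ∀ t, T ≤ t → ∀ i ∈ C, |x t i - c| < ε := by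
    intro ε hε
    obtain ⟨N, hN⟩ := exists_forall_sum_Ico_lt hout (κ := ε / (4 * M)) (by positivity)
    obtain ⟨T, hT, hclose⟩ := hx.exists_close hA hM0 hM hdisp hout hconn (half_pos hε) (max s N)
    refine ⟨T, by omega, x T i₀, fun t ht i hi => ?_⟩
    have hs : 2 * M * ∑ τ ∈ Finset.Ico T t, cut (A τ) C Cᶜ < ε / 2 := by
      have h1 := hN T (by omega) t
      calc _ < 2 * M * (ε / (4 * M)) := by gcongr
        _ = ε / 2 := by field_simp; norm_num
    have h1 := hx.sub_le_on_set hA hM (t₀ := T) (by omega) (m := x T i₀ - ε / 2)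
      (fun j hj => by linarith [hclose i₀ hi₀ j hj]) ht hi
    have h2 := hx.neg.sub_le_on_set hA (M := M)
      (fun t ht i => by rw [abs_neg]; exact hM t ht i) (t₀ := T) (by omega)
      (m := -(x T i₀ + ε / 2)) (fun j hj => by linarith [hclose j hj i₀ hi₀]) ht hi
    rw [abs_lt]
    constructor <;> linarith
  obtain ⟨L, hL⟩ : ∃ L, Tendsto (fun t => x t i₀) atTop (𝓝 L) := by
    refine cauchySeq_tendsto_of_complete (Metric.cauchySeq_iff'.2 fun ε hε => ?_)
    obtain ⟨T, -, c, hc⟩ := band (ε / 2) (half_pos hε)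
    refine ⟨T, fun t ht => ?_⟩
    have h1 := abs_lt.1 (hc t ht i₀ hi₀)
    have h2 := abs_lt.1 (hc T le_rfl i₀ hi₀)
    rw [Real.dist_eq, abs_lt]
    constructor <;> linarith [h1.1, h1.2, h2.1, h2.2]
  refine ⟨L, fun i hi => ?_⟩
  have hdiff : Tendsto (fun t => x t i - x t i₀) atTop (𝓝 0) := by
    rw [Metric.tendsto_atTop]
    intro ε hε
    obtain ⟨T, -, c, hc⟩ := band (ε / 2) (half_pos hε)
    refine ⟨T, fun t ht => ?_⟩
    have h1 := abs_lt.1 (hc t ht i₀ hi₀)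
    have h2 := abs_lt.1 (hc t ht i hi)
    rw [Real.dist_eq, abs_lt]
    constructor <;> linarith [h1.1, h1.2, h2.1, h2.2]
  simpa using hdiff.add hL

/-! ### The infinite flow graph -/

lemma tsum_ofReal_eq_top_iff {f : ℕ → ℝ} (hf : ∀ t, 0 ≤ f t) :
    ∑' t, ENNReal.ofReal (f t) = ∞ ↔ ¬ Summable f := by
  refine ⟨fun h hs => hs.tsum_ofReal_ne_top h, fun h => ?_⟩
  by_contra h'
  refine h ((ENNReal.summable_toReal h').congr fun t => ?_)
  rw [ENNReal.toReal_ofReal (hf t)]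

lemma infiniteFlowGraph_adj (hA : IsStochasticChain A) {i j : Fin n} :
    (infiniteFlowGraph A).Adj i j ↔ i ≠ j ∧ ¬ Summable fun t => A t i j + A t j i := by
  rw [← tsum_ofReal_eq_top_iff fun t => add_nonneg (hA.nonneg t i j) (hA.nonneg t j i)]
  rfl

lemma exists_adj_of_ssubset {V : Type*} {G : SimpleGraph V} (C : G.ConnectedComponent) {S : Set V}
    (hne : S.Nonempty) (hS : S ⊂ C.supp) : ∃ i ∈ S, ∃ j ∈ C.supp, j ∉ S ∧ G.Adj i j := by
  obtain ⟨u, hu⟩ := hne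
  obtain ⟨v, hv, hvS⟩ := Set.exists_of_ssubset hS
  have huC : G.connectedComponentMk u = C := hS.1 hu
  have hvC : G.connectedComponentMk v = C := hv
  obtain ⟨p⟩ := SimpleGraph.ConnectedComponent.exact (huC.trans hvC.symm)
  obtain ⟨d, -, hd1, hd2⟩ := p.exists_boundary_dart S hu hvS
  refine ⟨d.fst, hd1, d.snd, ?_, hd2, d.adj⟩
  have h1 : G.connectedComponentMk d.fst = C := hS.1 hd1
  exact (SimpleGraph.ConnectedComponent.connectedComponentMk_eq_of_adj d.adj).symm.trans h1

open Classical in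
/-- The vertices of a connected component of the infinite flow graph. -/
noncomputable def compFinset (C : (infiniteFlowGraph A).ConnectedComponent) : Finset (Fin n) :=
  Finset.univ.filter fun i => (infiniteFlowGraph A).connectedComponentMk i = C

@[simp] lemma mem_compFinset {C : (infiniteFlowGraph A).ConnectedComponent} {i : Fin n} :
    i ∈ compFinset C ↔ (infiniteFlowGraph A).connectedComponentMk i = C := by
  simp [compFinset]

lemma coe_compFinset (C : (infiniteFlowGraph A).ConnectedComponent) :
    (compFinset C : Set (Fin n)) = C.supp := by
  ext i
  simp

lemma summable_cut_of_not_adj (hA : IsStochasticChain A) {S T : Finset (Fin n)}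
    (hdis : Disjoint S T) (h : ∀ i ∈ S, ∀ j ∈ T, ¬ (infiniteFlowGraph A).Adj i j) :
    Summable fun t => cut (A t) S T + cut (A t) T S := by
  have h1 : ∀ t, cut (A t) S T + cut (A t) T S = ∑ i ∈ S, ∑ j ∈ T, (A t i j + A t j i) := by
    intro t
    have h2 : cut (A t) T S = ∑ i ∈ S, ∑ j ∈ T, A t j i := Finset.sum_comm
    rw [h2, cut]
    simp only [Finset.sum_add_distrib]
  simp only [h1]
  refine summable_sum fun i hi => summable_sum fun j hj => ?_
  by_contra hs
  exact h i hi j hj ((infiniteFlowGraph_adj hA).2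
    ⟨fun e => Finset.disjoint_left.1 hdis hi (e ▸ hj), hs⟩)

lemma summable_cut_compFinset (hA : IsStochasticChain A)
    (C : (infiniteFlowGraph A).ConnectedComponent) :
    Summable fun t => cut (A t) (compFinset C) (compFinset C)ᶜ +
      cut (A t) (compFinset C)ᶜ (compFinset C) := by
  refine summable_cut_of_not_adj hA disjoint_compl_right fun i hi j hj hij => ?_
  rw [mem_compFinset] at hi
  rw [Finset.mem_compl, mem_compFinset] at hj
  exact hj ((SimpleGraph.ConnectedComponent.connectedComponentMk_eq_of_adj hij).symm.trans hi)

lemma summable_cut_left (hA : IsStochasticChain A) {S T : Finset (Fin n)}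
    (h : Summable fun t => cut (A t) S T + cut (A t) T S) : Summable fun t => cut (A t) S T :=
  h.of_nonneg_of_le (fun t => cut_nonneg hA t _ _)
    fun t => le_add_of_nonneg_right (cut_nonneg hA t _ _)

lemma not_summable_cut (hA : IsStochasticChain A) (C : (infiniteFlowGraph A).ConnectedComponent)
    {S : Finset (Fin n)} (hSC : S ⊆ compFinset C) (hS : S.Nonempty)
    (hne : (compFinset C \ S).Nonempty) :
    ¬ Summable fun t => cut (A t) S (compFinset C \ S) + cut (A t) (compFinset C \ S) S := by
  have hss : (S : Set (Fin n)) ⊂ C.supp := by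
    rw [← coe_compFinset]
    exact_mod_cast LE.le.ssubset_of_not_superset hSC (Finset.sdiff_nonempty.1 hne)
  obtain ⟨i, hi, j, hj, hjS, hij⟩ := exists_adj_of_ssubset C (by exact_mod_cast hS) hss
  have hj' : j ∈ compFinset C \ S :=
    Finset.mem_sdiff.2 ⟨mem_compFinset.2 hj, by exact_mod_cast hjS⟩
  intro hsum
  refine ((infiniteFlowGraph_adj hA).1 hij).2 (hsum.of_nonneg_of_le
    (fun t => add_nonneg (hA.nonneg t i j) (hA.nonneg t j i)) fun t => ?_)
  exact add_le_add (le_cut hA t (by exact_mod_cast hi) hj')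
    (le_cut hA t hj' (by exact_mod_cast hi))

/-- Over a connected component of the infinite flow graph, every proper jet has infinite total
interaction with its complement. -/
theorem infiniteJetFlow_supp (hA : IsStochasticChain A) (hap : StronglyAperiodic A)
    (C : (infiniteFlowGraph A).ConnectedComponent) : InfiniteJetFlow A C.supp := by
  obtain ⟨γ, hγ, hdiag⟩ := hap
  intro J hJ
  set g : ℕ → ℝ := fun t => cut (A t) (J (t + 1)) (J t)ᶜ + cut (A t) (J (t + 1))ᶜ (J t) with hg
  have hg0 : ∀ t, 0 ≤ g t := fun t => add_nonneg (cut_nonneg hA t _ _) (cut_nonneg hA t _ _)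
  refine (tsum_ofReal_eq_top_iff hg0).2 fun hsum => ?_
  -- An index entering or leaving `J` contributes its diagonal entry, at least `γ`; so `J` is
  -- constant after `T`, and an edge leaving it carries infinite weight.
  obtain ⟨T, hT⟩ := eventually_atTop.1 (hsum.tendsto_atTop_zero.eventually_lt_const hγ)
  have hstep : ∀ t, T ≤ t → J (t + 1) = J t := by
    intro t ht
    have hlt : cut (A t) (J (t + 1)) (J t)ᶜ + cut (A t) (J (t + 1))ᶜ (J t) < γ := hT t ht
    have h1 := cut_nonneg hA t (J (t + 1)) (J t)ᶜ
    have h2 := cut_nonneg hA t (J (t + 1))ᶜ (J t)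
    ext i
    by_contra hne
    by_cases hi : i ∈ J (t + 1)
    · have hi' : i ∈ (J t)ᶜ := Finset.mem_compl.2 fun h => hne ⟨fun _ => h, fun _ => hi⟩
      linarith [le_cut hA t hi hi', hdiag t i]
    · have hi' : i ∈ J t := by
        by_contra h
        exact hne ⟨fun h' => absurd h' hi, fun h' => absurd h' h⟩
      linarith [le_cut hA t (Finset.mem_compl.2 hi) hi', hdiag t i]
  have hconst : ∀ t, T ≤ t → J t = J T := by
    intro t ht
    induction t, ht using Nat.le_induction with
    | base => rfl
    | succ t ht ih => rw [hstep t ht, ih]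
  obtain ⟨i, hi, j, -, hj, hij⟩ := exists_adj_of_ssubset C (hJ T).1 (hJ T).2
  refine ((infiniteFlowGraph_adj hA).1 hij).2 ((summable_nat_add_iff T).1
    (((summable_nat_add_iff T).2 hsum).of_nonneg_of_le
      (fun t => add_nonneg (hA.nonneg _ i j) (hA.nonneg _ j i)) fun t => ?_))
  have h1 : J (t + T) = J T := hconst _ (by omega)
  have h2 : J (t + T + 1) = J T := hconst _ (by omega)
  have hi' : i ∈ J T := by exact_mod_cast hi
  have hj' : j ∈ (J T)ᶜ := Finset.mem_compl.2 (by exact_mod_cast hj)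
  simp only [hg, h1, h2]
  exact add_le_add (le_cut hA _ hi' hj') (le_cut hA _ hj' hi')

/-! ### Ergodic classes -/

/-- Consensus is reached along every orbit, within each component of the infinite flow graph. -/
theorem IsOrbit.exists_tendsto_component (hA : IsStochasticChain A) (hap : StronglyAperiodic A)
    (hrec : ApproximatelyReciprocal A) {s : ℕ} {x : ℕ → Fin n → ℝ} (hx : IsOrbit A s x)
    (C : (infiniteFlowGraph A).ConnectedComponent) :
    ∃ L, ∀ i ∈ compFinset C, Tendsto (fun t => x t i) atTop (𝓝 L) := by
  obtain ⟨δ, hδ, hcol⟩ := exists_le_colSum hA hap hrec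
  obtain ⟨γ, hγ, hdiag⟩ := hap
  exact hx.exists_tendsto hA (hx.summable_dispersion hA hγ hdiag hδ hcol)
    (summable_cut_left hA (summable_cut_compFinset hA C))
    fun S h1 h2 h3 => not_summable_cut hA C h1 h2 h3

theorem classErgodic (hA : IsStochasticChain A) (hap : StronglyAperiodic A)
    (hrec : ApproximatelyReciprocal A) : ClassErgodic A := by
  intro t₀
  have h : ∀ i k, ∃ l, Tendsto (fun t => backProd A t t₀ i k) atTop (𝓝 l) := fun i k => by
    obtain ⟨L, hL⟩ := (isOrbit_backProd_col A t₀ k).exists_tendsto_component hA hap hrec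
      ((infiniteFlowGraph A).connectedComponentMk i)
    exact ⟨L, hL i (mem_compFinset.2 rfl)⟩
  choose L hL using h
  exact ⟨Matrix.of L, tendsto_pi_nhds.2 fun i => tendsto_pi_nhds.2 fun k => hL i k⟩

/-- A set with summable interaction with its complement retains, from late times on, almost all of
the weights of its rows. -/
lemma exists_forall_sum_backProd (hA : IsStochasticChain A) {C : Finset (Fin n)}
    (h : Summable fun t => cut (A t) C Cᶜ + cut (A t) Cᶜ C) {ε : ℝ} (hε : 0 < ε) :
    ∃ N, ∀ t₀, N ≤ t₀ → ∀ t, t₀ ≤ t →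
      (∀ i ∈ C, 1 - ε ≤ ∑ k ∈ C, backProd A t t₀ i k) ∧
      ∀ i ∉ C, ∑ k ∈ C, backProd A t t₀ i k ≤ ε := by
  obtain ⟨N, hN⟩ := exists_forall_sum_Ico_lt h (half_pos hε)
  refine ⟨N, fun t₀ ht₀ t ht => ?_⟩
  -- This is the orbit of the indicator of `C`. It is bounded by `1`, so `2 · 1 · ε/2 = ε` bounds
  -- the drift.
  have hx : IsOrbit A t₀ (fun t i => ∑ k ∈ C, backProd A t t₀ i k) := by
    intro t ht i
    simp only [Finset.mul_sum]
    rw [Finset.sum_comm]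
    exact Finset.sum_congr rfl fun k _ => isOrbit_backProd_col A t₀ k t ht i
  have h0 : ∀ i, ∑ k ∈ C, backProd A t₀ t₀ i k = if i ∈ C then 1 else 0 := by
    intro i
    simp [Matrix.one_apply]
  have hM : ∀ t, t₀ ≤ t → ∀ i, |∑ k ∈ C, backProd A t t₀ i k| ≤ 1 := by
    intro t ht i
    refine hx.abs_apply_le hA (fun i => ?_) ht i
    rw [h0]
    split_ifs <;> simp
  have hlt := hN t₀ ht₀ t
  rw [Finset.sum_add_distrib] at hlt
  have h1 : 0 ≤ ∑ τ ∈ Finset.Ico t₀ t, cut (A τ) C Cᶜ :=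
    Finset.sum_nonneg fun τ _ => cut_nonneg hA τ _ _
  have h2 : 0 ≤ ∑ τ ∈ Finset.Ico t₀ t, cut (A τ) Cᶜ C :=
    Finset.sum_nonneg fun τ _ => cut_nonneg hA τ _ _
  constructor
  · intro i hi
    have := hx.sub_le_on_set hA hM le_rfl (S := C) (m := 1)
      (fun i hi => by rw [h0, if_pos hi]) ht hi
    linarith
  · intro i hi
    have := hx.neg.sub_le_on_set hA (M := 1) (fun t ht i => by rw [abs_neg]; exact hM t ht i)
      le_rfl (S := Cᶜ) (m := 0)
      (fun i hi => by rw [h0, if_neg (Finset.mem_compl.1 hi), neg_zero]) ht (Finset.mem_compl.2 hi)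
    rw [compl_compl] at this
    linarith

/-- For different components, late products give row `i` weight at least `3/4` on the component of
`i` and row `j` at most `1/4`, so the rows cannot merge. Within a component, columns of products are
orbits and reach consensus. -/
lemma ergodicSetoid_iff (hA : IsStochasticChain A) (hap : StronglyAperiodic A)
    (hrec : ApproximatelyReciprocal A) {i j : Fin n} :
    ergodicSetoid A i j ↔ (infiniteFlowGraph A).connectedComponentMk i =
      (infiniteFlowGraph A).connectedComponentMk j := by
  constructor
  · intro h
    by_contra hne
    set C := (infiniteFlowGraph A).connectedComponentMk i with hC
    obtain ⟨N, hN⟩ := exists_forall_sum_backProd hA (summable_cut_compFinset hA C)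
      (ε := 1 / 4) (by norm_num)
    have hlim : Tendsto (fun t => ∑ k ∈ compFinset C, (backProd A t N i k - backProd A t N j k))
        atTop (𝓝 0) := by
      simpa using tendsto_finsetSum (compFinset C) fun k _ => h N k
    obtain ⟨T, hT⟩ := eventually_atTop.1 (hlim.eventually_lt_const (u := 1 / 4) (by norm_num))
    have h1 := hT (max N T) (le_max_right _ _)
    obtain ⟨h2, h3⟩ := hN N le_rfl (max N T) (le_max_left _ _)
    have h4 := h2 i (mem_compFinset.2 rfl)
    have h5 := h3 j (fun h' => hne (mem_compFinset.1 h').symm)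
    rw [Finset.sum_sub_distrib] at h1
    linarith
  · intro h t₀ k
    obtain ⟨L, hL⟩ := (isOrbit_backProd_col A t₀ k).exists_tendsto_component hA hap hrec
      ((infiniteFlowGraph A).connectedComponentMk j)
    simpa using (hL i (mem_compFinset.2 h)).sub (hL j (mem_compFinset.2 rfl))

theorem ergodicClasses_eq (hA : IsStochasticChain A) (hap : StronglyAperiodic A)
    (hrec : ApproximatelyReciprocal A) :
    ergodicClasses A =
      Set.range fun C : (infiniteFlowGraph A).ConnectedComponent => C.supp := by
  have h : ∀ j : Fin n, {i | ergodicSetoid A i j} =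
      ((infiniteFlowGraph A).connectedComponentMk j).supp := by
    intro j
    ext i
    exact ergodicSetoid_iff hA hap hrec
  ext S
  constructor
  · rintro ⟨j, rfl⟩
    exact ⟨_, (h j).symm⟩
  · rintro ⟨C, rfl⟩
    induction C using SimpleGraph.ConnectedComponent.ind with
    | h j => exact ⟨j, (h j).symm⟩

/-! ### Absolute probability sequences -/

lemma IsAbsProbSeq.nonneg {π : ℕ → Fin n → ℝ} (h : IsAbsProbSeq A π) (t : ℕ) (i : Fin n) :
    0 ≤ π t i := (h t).1.1 i

lemma IsAbsProbSeq.le_one {π : ℕ → Fin n → ℝ} (h : IsAbsProbSeq A π) (t : ℕ) (i : Fin n) :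
    π t i ≤ 1 :=
  (h t).1.2 ▸ Finset.single_le_sum (fun i _ => h.nonneg t i) (Finset.mem_univ i)

lemma IsAbsProbSeq.apply_eq {π : ℕ → Fin n → ℝ} (h : IsAbsProbSeq A π) (t : ℕ) (j : Fin n) :
    π t j = ∑ i, π (t + 1) i * A t i j := by
  conv_lhs => rw [← (h t).2]
  rfl

/-- Every initial distribution gives rise, in the limit, to an absolute probability sequence. -/
lemma ClassErgodic.exists_isAbsProbSeq (hA : IsStochasticChain A) (hE : ClassErgodic A)
    {w : Fin n → ℝ} (hw : w ∈ stdSimplex ℝ (Fin n)) :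
    ∃ π, IsAbsProbSeq A π ∧
      ∀ t k, Tendsto (fun b => ∑ i, w i * backProd A b t i k) atTop (𝓝 (π t k)) := by
  choose L hL using hE
  have hlim : ∀ t k, Tendsto (fun b => ∑ i, w i * backProd A b t i k) atTop
      (𝓝 (∑ i, w i * L t i k)) := fun t k =>
    tendsto_finsetSum _ fun i _ =>
      (tendsto_pi_nhds.1 (tendsto_pi_nhds.1 (hL t) i) k).const_mul (w i)
  refine ⟨fun t k => ∑ i, w i * L t i k, fun t => ⟨⟨fun k => ?_, ?_⟩, ?_⟩, hlim⟩
  · refine ge_of_tendsto (hlim t k) (eventually_atTop.2 ⟨t, fun b hb => ?_⟩)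
    exact Finset.sum_nonneg fun i _ => mul_nonneg (hw.1 i) (hA.backProd_nonneg hb i k)
  · refine tendsto_nhds_unique (tendsto_finsetSum _ fun k _ => hlim t k)
      (tendsto_const_nhds.congr' (eventually_atTop.2 ⟨t, fun b hb => ?_⟩))
    dsimp only
    rw [Finset.sum_comm]
    simp only [← Finset.mul_sum, hA.backProd_sum_row hb, mul_one, hw.2]
  · ext k
    refine tendsto_nhds_unique (Tendsto.congr' (eventually_atTop.2 ⟨t + 1, fun b hb => ?_⟩)
      (tendsto_finsetSum Finset.univ fun j _ => (hlim (t + 1) j).mul_const (A t j k))) (hlim t k)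
    simp only [backProd_eq_mul A (Nat.lt_of_succ_le hb), Matrix.mul_apply, Finset.mul_sum,
      Finset.sum_mul]
    rw [Finset.sum_comm]
    simp only [mul_assoc]

/-- The volume of a set with summable interaction with its complement converges. -/
lemma IsAbsProbSeq.exists_tendsto_sum (hA : IsStochasticChain A) {π : ℕ → Fin n → ℝ}
    (hπ : IsAbsProbSeq A π) {C : Finset (Fin n)}
    (h : Summable fun t => cut (A t) C Cᶜ + cut (A t) Cᶜ C) :
    ∃ m, Tendsto (fun t => ∑ i ∈ C, π t i) atTop (𝓝 m) := by
  refine cauchySeq_tendsto_of_complete (cauchySeq_of_summable_dist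
    (h.of_nonneg_of_le (fun t => dist_nonneg) fun t => ?_))
  have hbound : ∀ S T : Finset (Fin n), 0 ≤ ∑ i ∈ S, ∑ j ∈ T, π (t + 1) i * A t i j ∧
      ∑ i ∈ S, ∑ j ∈ T, π (t + 1) i * A t i j ≤ cut (A t) S T := fun S T =>
    ⟨Finset.sum_nonneg fun i _ => Finset.sum_nonneg fun j _ =>
      mul_nonneg (hπ.nonneg _ i) (hA.nonneg t i j),
    Finset.sum_le_sum fun i _ => Finset.sum_le_sum fun j _ =>
      mul_le_of_le_one_left (hA.nonneg t i j) (hπ.le_one _ i)⟩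
  -- The volumes at `t` and `t + 1` share the internal flow and differ only by the two crossing
  -- flows.
  have h1 : ∑ j ∈ C, π t j = (∑ i ∈ C, ∑ j ∈ C, π (t + 1) i * A t i j) +
      ∑ i ∈ Cᶜ, ∑ j ∈ C, π (t + 1) i * A t i j := by
    rw [Finset.sum_add_sum_compl, Finset.sum_comm]
    exact Finset.sum_congr rfl fun j _ => hπ.apply_eq t j
  have h2 : ∑ i ∈ C, π (t + 1) i = (∑ i ∈ C, ∑ j ∈ C, π (t + 1) i * A t i j) +
      ∑ i ∈ C, ∑ j ∈ Cᶜ, π (t + 1) i * A t i j := by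
    rw [← Finset.sum_add_distrib]
    refine Finset.sum_congr rfl fun i _ => ?_
    rw [Finset.sum_add_sum_compl, ← Finset.mul_sum, hA.sum_row, mul_one]
  have h3 := hbound C Cᶜ
  have h4 := hbound Cᶜ C
  rw [h1, h2, Real.dist_eq, abs_le]
  constructor <;> linarith

lemma IsAbsProbSeq.totalFlow_lt_top (hA : IsStochasticChain A) {π : ℕ → Fin n → ℝ}
    (hπ : IsAbsProbSeq A π) {S T : Finset (Fin n)} (hST : Disjoint S T)
    (h : Summable fun t => cut (A t) S Sᶜ + cut (A t) Sᶜ S) :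
    totalFlow A π (fun _ => S) (fun _ => T) < ∞ := by
  have hTS : T ⊆ Sᶜ := fun i hi => Finset.mem_compl.2 fun hi' => Finset.disjoint_left.1 hST hi' hi
  refine lt_of_le_of_lt (ENNReal.tsum_le_tsum fun t => ENNReal.ofReal_le_ofReal ?_)
    (lt_top_iff_ne_top.2 h.tsum_ofReal_ne_top)
  have hbound : ∀ S T : Finset (Fin n),
      ∑ i ∈ S, ∑ j ∈ T, π (t + 1) i * A t i j ≤ cut (A t) S T := fun S T =>
    Finset.sum_le_sum fun i _ => Finset.sum_le_sum fun j _ =>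
      mul_le_of_le_one_left (hA.nonneg t i j) (hπ.le_one _ i)
  exact add_le_add ((hbound S T).trans (cut_mono hA t subset_rfl hTS))
    ((hbound T S).trans (cut_mono hA t hTS subset_rfl))

/-! ### Sonin's jet decomposition -/

theorem exists_isSoninDecomposition (hn : 0 < n) (hA : IsStochasticChain A)
    (hap : StronglyAperiodic A) (hrec : ApproximatelyReciprocal A) :
    ∃ (c : ℕ) (J : Fin (c + 1) → Jet n), IsSoninDecomposition A c J := by
  classical
  have : Fintype (infiniteFlowGraph A).ConnectedComponent := Fintype.ofFinite _
  set e := (Fintype.equivFin (infiniteFlowGraph A).ConnectedComponent).symm with he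
  set S : Fin (Fintype.card (infiniteFlowGraph A).ConnectedComponent + 1) → Finset (Fin n) :=
    Fin.cons ∅ fun k => compFinset (e k) with hS
  have hS0 : S 0 = ∅ := rfl
  have hSs : ∀ k, S k.succ = compFinset (e k) := fun k => rfl
  have hpart : ∀ i, ∃! k, i ∈ S k := by
    intro i
    refine ⟨(e.symm ((infiniteFlowGraph A).connectedComponentMk i)).succ, by simp [hSs], ?_⟩
    intro k hk
    induction k using Fin.cases with
    | zero => simp [hS0] at hk
    | succ k =>
      rw [hSs, mem_compFinset] at hk
      rw [hk, Equiv.symm_apply_apply]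
  have hsum : ∀ k, Summable fun t => cut (A t) (S k) (S k)ᶜ + cut (A t) (S k)ᶜ (S k) := by
    intro k
    induction k using Fin.cases with
    | zero => simp [hS0, cut]
    | succ k => exact summable_cut_compFinset hA (e k)
  refine ⟨_, fun k _ => S k, ?_, fun _ => hpart, fun π hπ k => hπ.exists_tendsto_sum hA (hsum k),
    fun π _ => by simp [hS0], fun k => ?_, fun t₀ x₀ k => ?_, fun π hπ k l hkl => ?_⟩
  · exact Fintype.card_pos_iff.2 ⟨(infiniteFlowGraph A).connectedComponentMk ⟨0, hn⟩⟩
  · obtain ⟨i, hi⟩ := (e k).exists_rep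
    have hi : i ∈ S k.succ := by rw [hSs, mem_compFinset]; exact hi
    -- The point mass at an index `i` of the component serves as final distribution: late rows of
    -- `i` keep weight at least `1/2` in the component, hence so does `π`.
    obtain ⟨π, hπ, hlim⟩ := (classErgodic hA hap hrec).exists_isAbsProbSeq hA
      (single_mem_stdSimplex ℝ i)
    obtain ⟨m, hm⟩ := hπ.exists_tendsto_sum hA (hsum k.succ)
    refine ⟨π, hπ, m, ?_, hm⟩
    obtain ⟨N, hN⟩ := exists_forall_sum_backProd hA (hsum k.succ) (ε := 1 / 2) (by norm_num)
    have : (1 / 2 : ℝ) ≤ m := by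
      refine ge_of_tendsto hm (eventually_atTop.2 ⟨N, fun t ht => ?_⟩)
      refine ge_of_tendsto (tendsto_finsetSum _ fun k _ => hlim t k)
        (eventually_atTop.2 ⟨t, fun b hb => ?_⟩)
      have h1 := (hN t ht b hb).1 i hi
      simp only [Pi.single_apply, ite_mul, one_mul, zero_mul, Finset.sum_ite_eq', Finset.mem_univ,
        if_true]
      linarith
    linarith
  · obtain ⟨L, hL⟩ := (isOrbit_backProd A t₀ x₀).exists_tendsto_component hA hap hrec (e k)
    refine ⟨L, fun ε hε => ?_⟩
    have h1 : ∀ᶠ t in atTop, ∀ i ∈ compFinset (e k), |(backProd A t t₀).mulVec x₀ i - L| < ε := by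
      rw [Filter.eventually_all_finset]
      exact fun i hi => Metric.tendsto_nhds.1 (hL i hi) ε hε
    obtain ⟨T, hT⟩ := eventually_atTop.1 h1
    exact ⟨T, fun t _ ht => hT t ht⟩
  · refine hπ.totalFlow_lt_top hA (Finset.disjoint_left.2 fun i hk hl => hkl ?_) (hsum k)
    exact (hpart i).unique hk hl

/-- There is an absolute probability sequence bounded away from zero. -/
lemma exists_isAbsProbSeq_ge (hn : 0 < n) (hA : IsStochasticChain A)
    (hap : StronglyAperiodic A) (hrec : ApproximatelyReciprocal A) :
    ∃ π, IsAbsProbSeq A π ∧ ∃ p : ℝ, 0 < p ∧ ∀ t i, p ≤ π t i := by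
  have hn' : (0 : ℝ) < n := by exact_mod_cast hn
  obtain ⟨δ, hδ, hcol⟩ := exists_le_colSum hA hap hrec
  -- With the uniform distribution, `π t i` is the limit of column sums divided by `n`.
  obtain ⟨π, hπ, hlim⟩ := (classErgodic hA hap hrec).exists_isAbsProbSeq hA
    (w := fun _ => (n : ℝ)⁻¹) ⟨fun _ => by positivity, by simp [hn'.ne']⟩
  refine ⟨π, hπ, (n : ℝ)⁻¹ * δ, by positivity, fun t i => ?_⟩
  refine ge_of_tendsto (hlim t i) (eventually_atTop.2 ⟨t, fun b hb => ?_⟩)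
  rw [← Finset.mul_sum]
  exact mul_le_mul_of_nonneg_left (hcol t b hb i) (by positivity)

/-- From some time on, all the jets of a Sonin decomposition are constant, and there is no edge of
the infinite flow graph between two of them. -/
lemma IsSoninDecomposition.exists_forall_eq {c : ℕ} {J : Fin (c + 1) → Jet n}
    (hJ : IsSoninDecomposition A c J) (hA : IsStochasticChain A) (hap : StronglyAperiodic A)
    {π : ℕ → Fin n → ℝ} (hπ : IsAbsProbSeq A π) {p : ℝ} (hp : 0 < p) (hpπ : ∀ t i, p ≤ π t i) :
    ∃ T, (∀ t, T ≤ t → ∀ k, J k t = J k T) ∧ J 0 T = ∅ ∧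
      ∀ k l, k ≠ l → ∀ i ∈ J k T, ∀ j ∈ J l T, ¬ (infiniteFlowGraph A).Adj i j := by
  obtain ⟨γ, hγ, hdiag⟩ := hap
  set g : Fin (c + 1) → Fin (c + 1) → ℕ → ℝ := fun k l t =>
    (∑ i ∈ J k (t + 1), ∑ j ∈ J l t, π (t + 1) i * A t i j) +
      ∑ i ∈ J l (t + 1), ∑ j ∈ J k t, π (t + 1) i * A t i j with hg
  have hpA : ∀ t i j, p * A t i j ≤ π (t + 1) i * A t i j := fun t i j =>
    mul_le_mul_of_nonneg_right (hpπ _ i) (hA.nonneg t i j)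
  have hcut : ∀ k l t, p * (cut (A t) (J k (t + 1)) (J l t) + cut (A t) (J l (t + 1)) (J k t)) ≤
      g k l t := by
    intro k l t
    rw [mul_add]
    refine add_le_add ?_ ?_ <;>
    · simp only [cut, Finset.mul_sum]
      exact Finset.sum_le_sum fun i _ => Finset.sum_le_sum fun j _ => hpA t i j
  have hg0 : ∀ k l t, 0 ≤ g k l t := fun k l t =>
    (mul_nonneg hp.le (add_nonneg (cut_nonneg hA t _ _) (cut_nonneg hA t _ _))).trans (hcut k l t)
  have hsum : ∀ k l, k ≠ l → Summable (g k l) := by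
    intro k l hkl
    by_contra h
    exact (hJ.flow π hπ k l hkl).ne ((tsum_ofReal_eq_top_iff (hg0 k l)).2 h)
  -- An index moving between jets carries flow at least `p γ` through its diagonal entry, so below
  -- this threshold no index moves.
  have hev : ∀ᶠ t in atTop, ∀ k l, k ≠ l → g k l t < p * γ := by
    rw [eventually_all]
    intro k
    rw [eventually_all]
    intro l
    by_cases hkl : k = l
    · simp [hkl]
    · filter_upwards [(hsum k l hkl).tendsto_atTop_zero.eventually_lt_const
        (mul_pos hp hγ)] with t ht _ using ht
  have hev0 : ∀ᶠ t in atTop, J 0 t = ∅ := by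
    filter_upwards [(hJ.volume_zero π hπ).eventually_lt_const hp] with t ht
    rw [Finset.eq_empty_iff_forall_notMem]
    intro i hi
    have := Finset.single_le_sum (f := π t) (fun i _ => hπ.nonneg t i) hi
    linarith [hpπ t i]
  obtain ⟨T, hT⟩ := eventually_atTop.1 (hev.and hev0)
  have hmem : ∀ t, T ≤ t → ∀ k, ∀ i ∈ J k t, i ∈ J k (t + 1) := by
    intro t ht k i hi
    obtain ⟨l, hl, -⟩ := hJ.partition (t + 1) i
    by_cases hkl : l = k
    · exact hkl ▸ hl
    · have h1 := (hT t ht).1 l k hkl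
      have h2 := hcut l k t
      have h3 := le_cut hA t hl hi
      have h4 := cut_nonneg hA t (J k (t + 1)) (J l t)
      have h5 := hdiag t i
      nlinarith
  have hstep : ∀ t, T ≤ t → ∀ k, J k (t + 1) = J k t := by
    intro t ht k
    refine Finset.Subset.antisymm (fun i hi => ?_) (hmem t ht k)
    obtain ⟨l, hl, -⟩ := hJ.partition t i
    have := (hJ.partition (t + 1) i).unique hi (hmem t ht l i hl)
    exact this ▸ hl
  have hconst : ∀ t, T ≤ t → ∀ k, J k t = J k T := by
    intro t ht
    induction t, ht using Nat.le_induction with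
    | base => exact fun _ => rfl
    | succ t ht ih => exact fun k => (hstep t ht k).trans (ih k)
  refine ⟨T, hconst, (hT T le_rfl).2, fun k l hkl i hi j hj hij => ?_⟩
  refine ((infiniteFlowGraph_adj hA).1 hij).2 ((summable_nat_add_iff T).1
    ((((summable_nat_add_iff T).2 (hsum k l hkl)).mul_left p⁻¹).of_nonneg_of_le
      (fun t => add_nonneg (hA.nonneg _ i j) (hA.nonneg _ j i)) fun t => ?_))
  have h1 := hcut k l (t + T)
  rw [hconst (t + T) (by omega), hconst (t + T) (by omega), hconst (t + T + 1) (by omega),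
    hconst (t + T + 1) (by omega)] at h1
  rw [le_inv_mul_iff₀ hp]
  refine le_trans (mul_le_mul_of_nonneg_left ?_ hp.le) h1
  exact add_le_add (le_cut hA _ hi hj) (le_cut hA _ hj hi)

/-- No edges between the final jets makes them unions of components; a common concentration for
every initial vector puts each `J k.succ` in one ergodic class, hence in one component; positive
volume makes it nonempty. -/
theorem IsSoninDecomposition.hasLimit (hn : 0 < n) (hA : IsStochasticChain A)
    (hap : StronglyAperiodic A) (hrec : ApproximatelyReciprocal A) {c : ℕ}
    {J : Fin (c + 1) → Jet n} (hJ : IsSoninDecomposition A c J) :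
    (J 0).HasLimit ∅ ∧ ∃ e : Fin c ≃ (infiniteFlowGraph A).ConnectedComponent,
      ∀ k : Fin c, (J k.succ).HasLimit (e k).supp := by
  obtain ⟨π, hπ, p, hp, hpπ⟩ := exists_isAbsProbSeq_ge hn hA hap hrec
  obtain ⟨T, hconst, hempty, hadj⟩ := hJ.exists_forall_eq hA hap hπ hp hpπ
  refine ⟨⟨T, fun t ht => by rw [hconst t ht, hempty, Finset.coe_empty]⟩, ?_⟩
  have hreach : ∀ k i j, (infiniteFlowGraph A).connectedComponentMk i =
      (infiniteFlowGraph A).connectedComponentMk j → i ∈ J k T → j ∈ J k T := by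
    intro k i j hij hi
    by_contra hj
    obtain ⟨w⟩ := SimpleGraph.ConnectedComponent.exact hij
    obtain ⟨d, -, hd1, hd2⟩ := w.exists_boundary_dart (J k T : Set (Fin n)) hi hj
    obtain ⟨l, hl, -⟩ := hJ.partition T d.snd
    refine hadj k l ?_ d.fst hd1 d.snd hl d.adj
    rintro rfl
    exact hd2 hl
  have hsame : ∀ (k : Fin c), ∀ i ∈ J k.succ T, ∀ j ∈ J k.succ T,
      (infiniteFlowGraph A).connectedComponentMk i =
        (infiniteFlowGraph A).connectedComponentMk j := by
    intro k i hi j hj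
    rw [← ergodicSetoid_iff hA hap hrec]
    intro t₀ l
    -- The unit vector at `l` selects column `l` of the product.
    obtain ⟨L, hL⟩ := hJ.concentration t₀ (Pi.single l 1) k
    have hlim : ∀ i ∈ J k.succ T, Tendsto (fun t => backProd A t t₀ i l) atTop (𝓝 L) := by
      intro i hi
      rw [Metric.tendsto_atTop]
      intro ε hε
      obtain ⟨N, hN⟩ := hL ε hε
      refine ⟨max (max N t₀) T, fun t ht => ?_⟩
      have := hN t (by omega) (by omega) i (by rw [hconst t (by omega)]; exact hi)
      simpa [Real.dist_eq] using this
    simpa using (hlim i hi).sub (hlim j hj)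
  have hne : ∀ k : Fin c, ∃ i, i ∈ J k.succ T := by
    intro k
    by_contra! hno
    obtain ⟨π', -, m, hm, hlim⟩ := hJ.volume_pos k
    refine hm.ne (tendsto_nhds_unique (tendsto_const_nhds.congr' ?_) hlim)
    filter_upwards [eventually_ge_atTop T] with t ht
    rw [hconst t ht, Finset.eq_empty_iff_forall_notMem.2 hno, Finset.sum_empty]
  choose r hr using hne
  refine ⟨Equiv.ofBijective (fun k => (infiniteFlowGraph A).connectedComponentMk (r k))
    ⟨fun k l hkl => ?_, fun C => ?_⟩, fun k => ⟨T, fun t ht => ?_⟩⟩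
  · exact Fin.succ_injective _ ((hJ.partition T (r l)).unique
      (hreach k.succ (r k) (r l) hkl (hr k)) (hr l))
  · induction C using SimpleGraph.ConnectedComponent.ind with
    | h i =>
      obtain ⟨k, hk, -⟩ := hJ.partition T i
      induction k using Fin.cases with
      | zero => simp [hempty] at hk
      | succ k => exact ⟨k, hsame k (r k) (hr k) i hk⟩
  · rw [hconst t ht]
    ext i
    exact ⟨fun hi => hsame k i hi (r k) (hr k), fun hi => hreach k.succ (r k) i hi.symm (hr k)⟩

end StochasticChain

theorem corollary4 (n : ℕ) (hn : 0 < n) (A : ℕ → Matrix (Fin n) (Fin n) ℝ)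
    (hA : StochasticChain.IsStochasticChain A)
    (hap : StochasticChain.StronglyAperiodic A)
    (hrec : StochasticChain.ApproximatelyReciprocal A) :
    (∀ C : (StochasticChain.infiniteFlowGraph A).ConnectedComponent,
      StochasticChain.InfiniteJetFlow A C.supp) ∧
    StochasticChain.ClassErgodic A ∧
    StochasticChain.ergodicClasses A =
      Set.range (fun C : (StochasticChain.infiniteFlowGraph A).ConnectedComponent => C.supp) ∧
    (∃ (c : ℕ) (J : Fin (c + 1) → StochasticChain.Jet n),
      StochasticChain.IsSoninDecomposition A c J) ∧
    (∀ (c : ℕ) (J : Fin (c + 1) → StochasticChain.Jet n),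
      StochasticChain.IsSoninDecomposition A c J →
        (J 0).HasLimit ∅ ∧
        ∃ e : Fin c ≃ (StochasticChain.infiniteFlowGraph A).ConnectedComponent,
          ∀ k : Fin c, (J k.succ).HasLimit (e k).supp) :=
  ⟨fun C => StochasticChain.infiniteJetFlow_supp hA hap C,
    StochasticChain.classErgodic hA hap hrec,
    StochasticChain.ergodicClasses_eq hA hap hrec,
    StochasticChain.exists_isSoninDecomposition hn hA hap hrec,
    fun _ _ hJ => hJ.hasLimit hn hA hap hrec⟩
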